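/- **Model.** Let $h$ be a real random variable whose law $\mu$ is symmetric about $0$, let $\theta>0$, and let $S_0\subset[n]$ with $|S_0|=k$. Under the alternative $\mathbb P_{S_0}$ one observes $m$ independent copies $\sigma^{(1)},\dots,\sigma^{(m)}$ of a random $\sigma\in\{-1,1\}^n$: the (unobserved) fields $h_1,\dots,h_n$ are i.i.d. with law $\mu$ (fresh for each copy) and, given them, $$\mathbb P_{S_0}(\sigma\mid h)\ \propto\ \exp\Big(\frac{\theta}{2k}\Big(\sum_{i\in S_0}\sigma_i\Big)^2+\sum_{i=1}^n h_i\sigma_i\Big).$$ Under the null hypothesis $\mathbb P_0$ the quadratic term is absent. For $S\subset[n]$ with $|S|=k$ let $W_S=\frac1k\sum_{i,j\in S}\sigma_i\sigma_j$ (diagonal terms included) and $\phi_S=\frac1k\big(\frac1m\sum_{l=1}^m(\sum_{i\in S}\sigma^{(l)}_i)^2-k\big)$. For a threshold $\tau$, the *local (scan) test* rejects $\mathbb P_0$ if $\max_{|S|=k}\phi_S\ge\tau$, and the *global test* rejects $\mathbb P_0$ if $\frac1k\big(\frac1m\sum_{l=1}^m(\sum_{i=1}^n\sigma^{(l)}_i)^2-n\big)\ge\tau$;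 the *combined test* is the local test if $k<n^{2/3}$ and the global test if $k\ge n^{2/3}$. The risk of a test against $S_0$ is the sum of its Type I error under $\mathbb P_0$ and its Type II error under $\mathbb P_{S_0}$. Put $q=\mathbb E[\operatorname{sech}^2 h]$ and $V=\dfrac{1-\theta q^2}{(1-\theta q)^2}$. We say that a threshold $\tau$ is *good* if the following three statements hold. * (Local.) There is $C>0$ such that for every $\delta>0$ there is $K$ such that for all $n,m$ and all $S_0\subset[n]$ with $K\le k=|S_0|\le n/2$ and $m\ge C\,k\log(n/k)$, the risk of the local test is at most $\delta$. * (Global.) For every $\delta>0$ there are $C>0$ and $K$ such that for all $n,m$ and all $S_0\subset[n]$ with $k=|S_0|\ge K$ and $m\ge C\,n^2/k^2$, the risk of the global test is at most $\delta$. * (Combined.) For every $\delta>0$ there are $C>0$ and $K$ such that for all $n,m$ and all $S_0\subset[n]$ with $k=|S_0|\ge K$, and with $m\ge C\,k\log(n/k)$ if $k<n^{2/3}$ and $m\ge C\,n^2/k^2$ if $k\ge n^{2/3}$, the risk of the combined test is at most $\delta$. **Theorem.** Assume $0<\theta<1/\mathbb E[\operatorname{sech}^2h]$. Then $V>1$,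 and there is a good threshold $\tau>0$. If moreover $0$ is the unique global minimizer of the mean-field free energy $x\mapsto\frac{x^2}{2}-\mathbb E\big[\log\cosh(\sqrt\theta x+h)-\log\cosh h\big]$, then $$\mathbb E_{S_0}[W_{S_0}]\longrightarrow V=\frac{1-\theta\,\mathbb E[\operatorname{sech}^2h]^2}{(1-\theta\,\mathbb E[\operatorname{sech}^2h])^2}\qquad(k=|S_0|\to\infty),$$ and every $\tau\in(0,V-1)$ is a good threshold. -/

import Mathlib

open MeasureTheory Filter Topology

noncomputable section

namespace PlantedRFCW

/-- A configuration of `n` Ising spins; `true` stands for `+1` and `false` for `-1`. -/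
abbrev Config (n : ℕ) : Type := Fin n → Bool

/-- The numerical value of a spin. -/
def spin (b : Bool) : ℝ := if b then 1 else -1

/-- The sum of the spins with index in `S`. -/
def spinSum {n : ℕ} (S : Finset (Fin n)) (σ : Config n) : ℝ := ∑ i ∈ S, spin (σ i)

/-- The unnormalized Gibbs weight
`exp (θ / (2 |S|) * (∑_{i ∈ S} σ_i)^2 + ∑_i h_i σ_i)`. -/
def weight {n : ℕ} (θ : ℝ) (S : Finset (Fin n)) (h : Fin n → ℝ) (σ : Config n) : ℝ :=
  Real.exp (θ / (2 * (S.card : ℝ)) * spinSum S σ ^ 2 + ∑ i, h i * spin (σ i))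

/-- The Gibbs probability of `σ` given the field `h`. -/
def gibbs {n : ℕ} (θ : ℝ) (S : Finset (Fin n)) (h : Fin n → ℝ) (σ : Config n) : ℝ :=
  weight θ S h σ / ∑ σ' : Config n, weight θ S h σ'

/-- The law of one observed configuration: the fields `h_i` are i.i.d. with law `μ` and are not
observed, and given them the spins follow the Gibbs measure with clique `S`. -/
def plantedLaw {n : ℕ} (μ : Measure ℝ) (θ : ℝ) (S : Finset (Fin n)) : Measure (Config n) :=
  ∑ σ : Config n,
    ENNReal.ofReal (∫ h : Fin n → ℝ, gibbs θ S h σ ∂(Measure.pi fun _ => μ)) • Measure.dirac σ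

/-- The law of one configuration under the null hypothesis (no interaction): given `h`, the
weight is `exp (∑_i h_i σ_i)`. -/
def nullLaw (n : ℕ) (μ : Measure ℝ) : Measure (Config n) := plantedLaw μ 0 ∅

/-- Type I error plus Type II error, against the clique `S₀`, of the test based on `m` i.i.d.
configurations that rejects the null hypothesis on the set `R`. -/
def risk {n : ℕ} (μ : Measure ℝ) (θ : ℝ) (S₀ : Finset (Fin n)) (m : ℕ)
    (R : Set (Fin m → Config n)) : ℝ :=
  (Measure.pi fun _ : Fin m => nullLaw n μ).real R +
    (Measure.pi fun _ : Fin m => plantedLaw μ θ S₀).real Rᶜ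

/-- `W_S = (1 / |S|) ∑_{i, j ∈ S} σ_i σ_j`, the diagonal terms being included. -/
def pairStat {n : ℕ} (S : Finset (Fin n)) (σ : Config n) : ℝ :=
  (1 / (S.card : ℝ)) * ∑ i ∈ S, ∑ j ∈ S, spin (σ i) * spin (σ j)

/-- `φ_S = (1 / k) (1_Sᵀ Ê[σ σᵀ] 1_S - k)`, with `k = |S|` and `Ê` the average over the `m`
configurations. -/
def localStat {n m : ℕ} (S : Finset (Fin n)) (x : Fin m → Config n) : ℝ :=
  (1 / (S.card : ℝ)) *
    ((∑ i ∈ S, ∑ j ∈ S, (1 / (m : ℝ)) * ∑ l, spin (x l i) * spin (x l j)) - (S.card : ℝ))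

/-- The scan statistic: the maximum of `φ_S` over all `S` with `|S| = k`. -/
def scanStat {n m : ℕ} (k : ℕ) (x : Fin m → Config n) : ℝ :=
  ⨆ S : {S : Finset (Fin n) // S.card = k}, localStat S.1 x

/-- The global statistic `(1 / k) ((1 / m) ∑_l (∑_i σ_i^{(l)})^2 - n)`. -/
def globalStat {n m : ℕ} (k : ℕ) (x : Fin m → Config n) : ℝ :=
  (1 / (k : ℝ)) * ((1 / (m : ℝ)) * (∑ l, spinSum Finset.univ (x l) ^ 2) - (n : ℝ))

/-- Rejection region of the local (scan) test. -/
def scanTest (n m k : ℕ) (τ : ℝ) : Set (Fin m → Config n) := {x | τ ≤ scanStat k x}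

/-- Rejection region of the global test. -/
def globalTest (n m k : ℕ) (τ : ℝ) : Set (Fin m → Config n) := {x | τ ≤ globalStat k x}

/-- The two tests together: the local test if `k < n ^ (2 / 3)`, and otherwise the global one. -/
def combinedTest (n m k : ℕ) (τ : ℝ) : Set (Fin m → Config n) :=
  if k ^ 3 < n ^ 2 then scanTest n m k τ else globalTest n m k τ

/-- `k log (n / k)`. -/
def localRate (n k : ℕ) : ℝ := (k : ℝ) * Real.log ((n : ℝ) / (k : ℝ))

/-- `n ^ 2 / k ^ 2`. -/
def globalRate (n k : ℕ) : ℝ := (n : ℝ) ^ 2 / (k : ℝ) ^ 2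

/-- For `k ≤ n / 2`, the local test with threshold `τ` has vanishing risk as `k → ∞`, uniformly
in `n`, in the clique and in `m ≥ C k log (n / k)`. -/
def ScanTestSucceeds (μ : Measure ℝ) (θ τ : ℝ) : Prop :=
  ∃ C : ℝ, 0 < C ∧ ∀ δ : ℝ, 0 < δ → ∃ K : ℕ, ∀ (n m : ℕ) (S₀ : Finset (Fin n)),
    K ≤ S₀.card → 2 * S₀.card ≤ n → C * localRate n S₀.card ≤ (m : ℝ) →
      risk μ θ S₀ m (scanTest n m S₀.card τ) ≤ δ

/-- For every `δ`, the global test with threshold `τ` has risk at most `δ` if `k` is large and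
`m ≥ C n ^ 2 / k ^ 2`, with `C = C (δ)`. -/
def GlobalTestSucceeds (μ : Measure ℝ) (θ τ : ℝ) : Prop :=
  ∀ δ : ℝ, 0 < δ → ∃ C : ℝ, 0 < C ∧ ∃ K : ℕ, ∀ (n m : ℕ) (S₀ : Finset (Fin n)),
    K ≤ S₀.card → C * globalRate n S₀.card ≤ (m : ℝ) →
      risk μ θ S₀ m (globalTest n m S₀.card τ) ≤ δ

/-- The two tests together succeed with `m ≥ C k log (n / k)` samples if `k < n ^ (2 / 3)` and
`m ≥ C n ^ 2 / k ^ 2` samples otherwise. -/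
def CombinedTestSucceeds (μ : Measure ℝ) (θ τ : ℝ) : Prop :=
  ∀ δ : ℝ, 0 < δ → ∃ C : ℝ, 0 < C ∧ ∃ K : ℕ, ∀ (n m : ℕ) (S₀ : Finset (Fin n)),
    K ≤ S₀.card →
    C * (if S₀.card ^ 3 < n ^ 2 then localRate n S₀.card else globalRate n S₀.card) ≤ (m : ℝ) →
      risk μ θ S₀ m (combinedTest n m S₀.card τ) ≤ δ

/-- `E[sech²(h)]` for `h` with law `μ`. -/
def meanSechSq (μ : Measure ℝ) : ℝ := ∫ h, 1 / Real.cosh h ^ 2 ∂μ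

/-- `(1 - θ E[sech²(h)]²) / (1 - θ E[sech²(h)])²`. -/
def limitSecondMoment (μ : Measure ℝ) (θ : ℝ) : ℝ :=
  (1 - θ * meanSechSq μ ^ 2) / (1 - θ * meanSechSq μ) ^ 2

/-- The mean-field free energy `x² / 2 - E[log cosh (√θ x + h)]`, normalized to vanish at `x = 0`.
The normalized integrand is bounded for each `x`, so that no moment of `h` is needed. -/
def freeEnergy (μ : Measure ℝ) (θ x : ℝ) : ℝ :=
  x ^ 2 / 2 - ∫ h, (Real.log (Real.cosh (Real.sqrt θ * x + h)) - Real.log (Real.cosh h)) ∂μ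

/-- The point `0` is the only global minimizer of the mean-field free energy. -/
def ZeroUniqueMinimizer (μ : Measure ℝ) (θ : ℝ) : Prop :=
  ∀ x : ℝ, x ≠ 0 → freeEnergy μ θ 0 < freeEnergy μ θ x

end PlantedRFCW

end

/-!
The Hubbard–Stratonovich transform replaces the interaction by an auxiliary variable: given the
field `h` and `y`, the clique spins are independent in the field `h + √(θ / k) y`, where `y` has the
standard Gaussian density tilted by `∏ cosh (h_i + √(θ / k) y)`. The identity
`E[y²] = 1 + θ E[W_S]` then turns the mean of `W_S` into a second moment of `y`. At `y = 0` the
logarithm of the tilt has slope `√θ k^{-1/2} ∑ tanh h_i` and curvature `θ k⁻¹ ∑ sech² h_i`. By the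
symmetry of `μ` the slope is centered, with variance `θ (1 - q)`; the curvature concentrates at
`θ q < 1`; together they give the limit `V`. The error is controlled by `E[y⁴]`. Where `y` is small
compared to `√k`, the Gaussian density dominates the tilt because `θ q < 1`; elsewhere the tilted
density decays like a Gaussian one, because the empirical free energy is close to the limiting one,
whose only global minimum is at `0`.

By the symmetry of `μ`, the signs of spins outside the clique are fair and independent of all else
(as are all signs under the null hypothesis), so their sums are sub-Gaussian. A Chernoff bound on
the squares of these sums, together with a union bound over the cliques for the scan test, controls
the error of type I. For the error of type II a lower bound on a truncated mean of `W_S` suffices,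
since averages of bounded variables concentrate. Without the condition on the free energy, such a
bound holds at weak coupling and propagates, because the law of `W_S` increases with `θ`.
-/

noncomputable section

namespace PlantedRFCW

open ProbabilityTheory
open scoped NNReal

/-! ### Gibbs averages -/

section Gibbs

variable {n : ℕ} (θ : ℝ) (S : Finset (Fin n))

/-- The average of `f` under the Gibbs measure with field `h`. -/
def gibbsAvg (h : Fin n → ℝ) (f : Config n → ℝ) : ℝ := ∑ σ, gibbs θ S h σ * f σ

lemma spin_sq (b : Bool) : spin b ^ 2 = 1 := by cases b <;> simp [spin]

lemma spin_not (b : Bool) : spin (!b) = -spin b := by cases b <;> simp [spin]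

lemma abs_spin (b : Bool) : |spin b| = 1 := by cases b <;> simp [spin]

lemma sum_weight_pos (h : Fin n → ℝ) : 0 < ∑ σ, weight θ S h σ :=
  Finset.sum_pos (fun _ _ => Real.exp_pos _) Finset.univ_nonempty

lemma gibbs_nonneg (h : Fin n → ℝ) (σ : Config n) : 0 ≤ gibbs θ S h σ :=
  div_nonneg (Real.exp_pos _).le (sum_weight_pos θ S h).le

lemma sum_gibbs (h : Fin n → ℝ) : ∑ σ, gibbs θ S h σ = 1 := by
  simp only [gibbs, ← Finset.sum_div]
  exact div_self (sum_weight_pos θ S h).ne'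

lemma gibbs_le_one (h : Fin n → ℝ) (σ : Config n) : gibbs θ S h σ ≤ 1 :=
  sum_gibbs θ S h ▸ Finset.single_le_sum (fun τ _ => gibbs_nonneg θ S h τ) (Finset.mem_univ σ)

lemma continuous_gibbs (σ : Config n) : Continuous fun h => gibbs θ S h σ := by
  have hw (τ : Config n) : Continuous fun h => weight θ S h τ := by unfold weight; fun_prop
  exact (hw σ).div (continuous_finsetSum _ fun τ _ => hw τ) fun h => (sum_weight_pos θ S h).ne'

lemma gibbsAvg_mono (h : Fin n → ℝ) {f g : Config n → ℝ} (hfg : ∀ σ, f σ ≤ g σ) :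
    gibbsAvg θ S h f ≤ gibbsAvg θ S h g :=
  Finset.sum_le_sum fun σ _ => mul_le_mul_of_nonneg_left (hfg σ) (gibbs_nonneg θ S h σ)

lemma gibbsAvg_const (h : Fin n → ℝ) (c : ℝ) : gibbsAvg θ S h (fun _ => c) = c := by
  rw [gibbsAvg, ← Finset.sum_mul, sum_gibbs, one_mul]

lemma gibbsAvg_eq_div (h : Fin n → ℝ) (f : Config n → ℝ) :
    gibbsAvg θ S h f = (∑ σ, weight θ S h σ * f σ) / ∑ σ, weight θ S h σ := by
  simp only [gibbsAvg, gibbs, Finset.sum_div, div_mul_eq_mul_div]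

variable (μ : Measure ℝ)

lemma plantedLaw_singleton (σ : Config n) :
    plantedLaw μ θ S {σ} =
      ENNReal.ofReal (∫ h, gibbs θ S h σ ∂(Measure.pi fun _ : Fin n => μ)) := by
  simp [plantedLaw, Measure.finsetSum_apply, Set.indicator_apply]

variable [IsProbabilityMeasure μ]

lemma integrable_gibbs (σ : Config n) :
    Integrable (fun h => gibbs θ S h σ) (Measure.pi fun _ : Fin n => μ) :=
  .of_bound (continuous_gibbs θ S σ).aestronglyMeasurable 1 <| ae_of_all _ fun h => by
    simpa only [Real.norm_of_nonneg (gibbs_nonneg θ S h σ)] using gibbs_le_one θ S h σ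

lemma integrable_gibbsAvg (f : Config n → ℝ) :
    Integrable (fun h => gibbsAvg θ S h f) (Measure.pi fun _ : Fin n => μ) :=
  integrable_finsetSum _ fun σ _ => (integrable_gibbs θ S μ σ).mul_const _

lemma integral_plantedLaw (f : Config n → ℝ) :
    ∫ σ, f σ ∂(plantedLaw μ θ S) = ∫ h, gibbsAvg θ S h f ∂(Measure.pi fun _ : Fin n => μ) := by
  unfold plantedLaw gibbsAvg
  rw [integral_finsetSum_measure
      fun σ _ => (integrable_dirac (by simp)).smul_measure ENNReal.ofReal_ne_top,
    integral_finsetSum _ fun σ _ => (integrable_gibbs θ S μ σ).mul_const _]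
  refine Finset.sum_congr rfl fun σ _ => ?_
  rw [integral_smul_measure, integral_dirac, integral_mul_const,
    ENNReal.toReal_ofReal (integral_nonneg fun h => gibbs_nonneg θ S h σ), smul_eq_mul]

instance isProbabilityMeasure_plantedLaw : IsProbabilityMeasure (plantedLaw μ θ S) := by
  constructor
  have h_sum : ∑ σ, ∫ h, gibbs θ S h σ ∂(Measure.pi fun _ : Fin n => μ) = 1 := by
    rw [← integral_finsetSum _ fun σ _ => integrable_gibbs θ S μ σ]
    simp [sum_gibbs]
  rw [← Set.toFinite Set.univ |>.coe_toFinset, ← sum_measure_singleton]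
  simp only [plantedLaw_singleton, Set.toFinite_toFinset, Set.toFinset_univ]
  rw [← ENNReal.ofReal_sum_of_nonneg fun σ _ => integral_nonneg fun h => gibbs_nonneg θ S h σ,
    h_sum, ENNReal.ofReal_one]

instance isProbabilityMeasure_nullLaw : IsProbabilityMeasure (nullLaw n μ) :=
  isProbabilityMeasure_plantedLaw 0 ∅ μ

end Gibbs

/-! ### Spins invariant under reversal -/

section Flip

variable {n : ℕ}

/-- The configuration with the spin at `j` reversed. -/
def flipAt (j : Fin n) (σ : Config n) : Config n := Function.update σ j (!σ j)

/-- The field with the value at `j` reversed. -/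
def negAt (j : Fin n) (h : Fin n → ℝ) : Fin n → ℝ := fun i => if i = j then -h i else h i

/-- The law `P` is invariant under the reversal of each single spin with index in `T`; equivalently,
conditionally on the other spins, those in `T` are independent and uniform. -/
def FlipInvariant (P : Measure (Config n)) (T : Finset (Fin n)) : Prop :=
  ∀ j ∈ T, MeasurePreserving (flipAt j) P P

lemma flipAt_apply_self (j : Fin n) (σ : Config n) : flipAt j σ j = !σ j := by simp [flipAt]

lemma flipAt_apply_of_ne {i j : Fin n} (hij : i ≠ j) (σ : Config n) : flipAt j σ i = σ i := by
  simp [flipAt, hij]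

lemma involutive_flipAt (j : Fin n) : Function.Involutive (flipAt j) := by
  intro σ
  ext i
  rcases eq_or_ne i j with rfl | hij
  · simp only [flipAt_apply_self, Bool.not_not]
  · simp only [flipAt_apply_of_ne hij]

lemma spinSum_flipAt_of_notMem {j : Fin n} {S : Finset (Fin n)} (hj : j ∉ S) (σ : Config n) :
    spinSum S (flipAt j σ) = spinSum S σ :=
  Finset.sum_congr rfl fun i hi => by rw [flipAt_apply_of_ne (ne_of_mem_of_not_mem hi hj)]

lemma spinSum_insert {j : Fin n} {T : Finset (Fin n)} (hj : j ∉ T) (σ : Config n) :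
    spinSum (insert j T) σ = spin (σ j) + spinSum T σ := Finset.sum_insert hj

lemma weight_flipAt {j : Fin n} {S : Finset (Fin n)} (hj : j ∉ S) (θ : ℝ) (h : Fin n → ℝ)
    (σ : Config n) : weight θ S h (flipAt j σ) = weight θ S (negAt j h) σ := by
  unfold weight
  rw [spinSum_flipAt_of_notMem hj]
  congr 2
  refine Finset.sum_congr rfl fun i _ => ?_
  rcases eq_or_ne i j with rfl | hij
  · simp [flipAt_apply_self, negAt, spin_not]
  · simp [flipAt_apply_of_ne hij, negAt, hij]

lemma gibbs_flipAt {j : Fin n} {S : Finset (Fin n)} (hj : j ∉ S) (θ : ℝ) (h : Fin n → ℝ)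
    (σ : Config n) : gibbs θ S h (flipAt j σ) = gibbs θ S (negAt j h) σ := by
  simp only [gibbs, ← weight_flipAt hj]
  congr 1
  exact (Equiv.sum_comp (involutive_flipAt j).toPerm (weight θ S h)).symm

lemma measurePreserving_negAt {μ : Measure ℝ} [IsProbabilityMeasure μ]
    (hsymm : μ.map (fun h => -h) = μ) (j : Fin n) :
    MeasurePreserving (negAt j) (Measure.pi fun _ : Fin n => μ) (Measure.pi fun _ => μ) := by
  refine measurePreserving_pi (fun _ => μ) (fun _ => μ)
    (f := fun i x => if i = j then -x else x) fun i => ?_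
  split_ifs
  · exact ⟨measurable_neg, hsymm⟩
  · exact MeasurePreserving.id μ

lemma flipInvariant_plantedLaw {μ : Measure ℝ} [IsProbabilityMeasure μ]
    (hsymm : μ.map (fun h => -h) = μ) (θ : ℝ) {S T : Finset (Fin n)} (hST : Disjoint S T) :
    FlipInvariant (plantedLaw μ θ S) T := by
  refine fun j hj => ⟨.of_discrete, Measure.ext_of_singleton fun σ => ?_⟩
  have hjS : j ∉ S := Finset.disjoint_right.1 hST hj
  have hpre : flipAt j ⁻¹' {σ} = {flipAt j σ} := by
    ext τ
    simp [(involutive_flipAt j).eq_iff]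
  have hmp := measurePreserving_negAt hsymm j
  rw [Measure.map_apply .of_discrete (.singleton σ), hpre, plantedLaw_singleton,
    plantedLaw_singleton]
  simp only [gibbs_flipAt hjS]
  rw [← integral_map (φ := negAt j) hmp.aemeasurable
    (continuous_gibbs θ S σ).aestronglyMeasurable, hmp.map_eq]

lemma flipInvariant_nullLaw {μ : Measure ℝ} [IsProbabilityMeasure μ]
    (hsymm : μ.map (fun h => -h) = μ) (T : Finset (Fin n)) : FlipInvariant (nullLaw n μ) T :=
  flipInvariant_plantedLaw hsymm 0 (Finset.disjoint_empty_left T)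

namespace FlipInvariant

variable {P : Measure (Config n)} {T : Finset (Fin n)}

lemma mono {T' : Finset (Fin n)} (hP : FlipInvariant P T) (hT : T' ⊆ T) : FlipInvariant P T' :=
  fun j hj => hP j (hT hj)

lemma integral_comp_flipAt (hP : FlipInvariant P T) {j : Fin n} (hj : j ∈ T)
    (F : Config n → ℝ) : ∫ σ, F (flipAt j σ) ∂P = ∫ σ, F σ ∂P := by
  rw [← integral_map (φ := flipAt j) (f := F) (hP j hj).aemeasurable .of_discrete,
    (hP j hj).map_eq]

lemma integral_spin_mul (hP : FlipInvariant P T) {j : Fin n} (hj : j ∈ T) {G : Config n → ℝ}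
    (hG : ∀ σ, G (flipAt j σ) = G σ) : ∫ σ, spin (σ j) * G σ ∂P = 0 := by
  have h := hP.integral_comp_flipAt hj fun σ => spin (σ j) * G σ
  simp only [hG, flipAt_apply_self, spin_not, neg_mul, integral_neg] at h
  linarith

variable [IsFiniteMeasure P]

lemma integral_mul_exp_mul_spin (hP : FlipInvariant P T) {j : Fin n} (hj : j ∈ T)
    {G t : Config n → ℝ} (hG : ∀ σ, G (flipAt j σ) = G σ) (ht : ∀ σ, t (flipAt j σ) = t σ) :
    ∫ σ, G σ * Real.exp (t σ * spin (σ j)) ∂P = ∫ σ, G σ * Real.cosh (t σ) ∂P := by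
  have hexp (σ : Config n) : G σ * Real.exp (t σ * spin (σ j)) =
      G σ * Real.cosh (t σ) + spin (σ j) * (G σ * Real.sinh (t σ)) := by
    rcases σ j <;> simp only [spin, Bool.false_eq_true, if_true, if_false, mul_one, mul_neg,
      Real.cosh_eq, Real.sinh_eq] <;> ring
  simp only [hexp]
  rw [integral_add .of_finite .of_finite,
    hP.integral_spin_mul hj fun σ => by rw [hG, ht], add_zero]

lemma integral_mul_exp_mul_spinSum (hP : FlipInvariant P T) {G t : Config n → ℝ}
    (hG : ∀ j ∈ T, ∀ σ, G (flipAt j σ) = G σ) (ht : ∀ j ∈ T, ∀ σ, t (flipAt j σ) = t σ) :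
    ∫ σ, G σ * Real.exp (t σ * spinSum T σ) ∂P = ∫ σ, G σ * Real.cosh (t σ) ^ T.card ∂P := by
  induction T using Finset.induction_on generalizing G with
  | empty => simp [spinSum]
  | insert j T hjT ih =>
    have hj : j ∈ insert j T := Finset.mem_insert_self j T
    have hsub : T ⊆ insert j T := Finset.subset_insert j T
    calc ∫ σ, G σ * Real.exp (t σ * spinSum (insert j T) σ) ∂P
        = ∫ σ, G σ * Real.exp (t σ * spinSum T σ) * Real.exp (t σ * spin (σ j)) ∂P := by
          simp only [spinSum_insert hjT, add_comm (spin _), mul_add, Real.exp_add, mul_assoc]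
      _ = ∫ σ, G σ * Real.exp (t σ * spinSum T σ) * Real.cosh (t σ) ∂P :=
          hP.integral_mul_exp_mul_spin hj
            (fun σ => by rw [hG j hj, ht j hj, spinSum_flipAt_of_notMem hjT]) (ht j hj)
      _ = ∫ σ, G σ * Real.cosh (t σ) * Real.exp (t σ * spinSum T σ) ∂P := by
          simp only [mul_right_comm]
      _ = ∫ σ, G σ * Real.cosh (t σ) * Real.cosh (t σ) ^ T.card ∂P :=
          ih (hP.mono hsub) (fun i hi σ => by rw [hG i (hsub hi), ht i (hsub hi)])
            fun i hi => ht i (hsub hi)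
      _ = ∫ σ, G σ * Real.cosh (t σ) ^ (insert j T).card ∂P := by
          simp only [Finset.card_insert_of_notMem hjT, pow_succ', mul_assoc]

end FlipInvariant

end Flip

/-! ### Sub-Gaussian random variables -/

section Subgaussian

lemma exp_neg_half_sq_add_mul (a y : ℝ) :
    Real.exp (-(y ^ 2 / 2) + a * y) = Real.exp (a ^ 2 / 2) * Real.exp (-(1 / 2) * (y - a) ^ 2) := by
  rw [← Real.exp_add]
  ring_nf

lemma integrable_exp_neg_half_sq_add_mul (a : ℝ) :
    Integrable fun y : ℝ => Real.exp (-(y ^ 2 / 2) + a * y) := by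
  simp only [exp_neg_half_sq_add_mul]
  exact ((integrable_exp_neg_mul_sq (b := 1 / 2) (by norm_num)).comp_sub_right a).const_mul _

lemma integral_exp_neg_half_sq_add_mul (a : ℝ) :
    ∫ y : ℝ, Real.exp (-(y ^ 2 / 2) + a * y) = √(2 * Real.pi) * Real.exp (a ^ 2 / 2) := by
  simp only [exp_neg_half_sq_add_mul]
  rw [integral_const_mul, integral_sub_right_eq_self (fun y => Real.exp (-(1 / 2) * y ^ 2)),
    integral_gaussian, mul_comm]
  ring_nf

lemma inv_one_sub_le_exp {x : ℝ} (h0 : 0 ≤ x) (h1 : x ≤ 1 / 2) :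
    (1 - x)⁻¹ ≤ Real.exp (x + x ^ 2) := by
  refine le_trans ?_ (Real.quadratic_le_exp_of_nonneg (x := x + x ^ 2) (by positivity))
  rw [inv_le_iff_one_le_mul₀' (by linarith)]
  have hcubic : 0 ≤ x ^ 2 * ((1 - x) * (1 + x) ^ 2 / 2 - x) := by
    apply mul_nonneg (sq_nonneg x)
    nlinarith [mul_nonneg h0 h0, mul_nonneg (mul_nonneg h0 h0) (by linarith : 0 ≤ 1 / 2 - x)]
  nlinarith [hcubic]

lemma exp_neg_le_quadratic {x : ℝ} (hx : 0 ≤ x) : Real.exp (-x) ≤ 1 - x + x ^ 2 / 2 := by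
  have hpos : 0 < 1 - x + x ^ 2 / 2 := by nlinarith [sq_nonneg (x - 1)]
  rw [Real.exp_neg, inv_le_comm₀ (Real.exp_pos x) hpos]
  refine le_trans ?_ (Real.quadratic_le_exp_of_nonneg hx)
  rw [inv_le_iff_one_le_mul₀ hpos]
  nlinarith [sq_nonneg (x ^ 2)]

variable {Ω : Type*} [MeasurableSpace Ω] {P : Measure Ω} {X : Ω → ℝ} {c : ℝ≥0} {l : ℝ}

-- Writing `exp (l x²)` as a Gaussian average of `exp (√(2l) y x)` makes the exponent linear in `x`.
lemma ofReal_exp_mul_sq_eq_lintegral (h0 : 0 ≤ l) (x : ℝ) :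
    ENNReal.ofReal (Real.exp (l * x ^ 2)) =
      ∫⁻ y : ℝ, ENNReal.ofReal
        ((√(2 * Real.pi))⁻¹ * Real.exp (-(y ^ 2 / 2) + √(2 * l) * x * y)) := by
  rw [← ofReal_integral_eq_lintegral_ofReal
      ((integrable_exp_neg_half_sq_add_mul _).const_mul _) (ae_of_all _ fun y => by positivity),
    integral_const_mul, integral_exp_neg_half_sq_add_mul, inv_mul_cancel_left₀ (by positivity),
    mul_pow, Real.sq_sqrt (by positivity)]
  ring_nf

lemma lintegral_gaussian_mul_exp_le_of_hasSubgaussianMGF (hX : HasSubgaussianMGF X c P)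
    (h0 : 0 ≤ l) (y : ℝ) :
    ∫⁻ ω, ENNReal.ofReal
        ((√(2 * Real.pi))⁻¹ * Real.exp (-(y ^ 2 / 2) + √(2 * l) * X ω * y)) ∂P ≤
      ENNReal.ofReal ((√(2 * Real.pi))⁻¹ * Real.exp (-(1 / 2 - l * c) * y ^ 2)) := by
  have hsplit (ω : Ω) : (√(2 * Real.pi))⁻¹ * Real.exp (-(y ^ 2 / 2) + √(2 * l) * X ω * y) =
      (√(2 * Real.pi))⁻¹ * Real.exp (-(y ^ 2 / 2)) * Real.exp (√(2 * l) * y * X ω) := by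
    rw [Real.exp_add, mul_right_comm (√(2 * l)) (X ω) y, ← mul_assoc]
  simp only [hsplit]
  rw [← ofReal_integral_eq_lintegral_ofReal ((hX.integrable_exp_mul _).const_mul _)
    (ae_of_all _ fun ω => by positivity), integral_const_mul]
  refine ENNReal.ofReal_le_ofReal ?_
  calc _ ≤ (√(2 * Real.pi))⁻¹ * Real.exp (-(y ^ 2 / 2)) *
          Real.exp (c * (√(2 * l) * y) ^ 2 / 2) := by
        gcongr
        exact hX.mgf_le (√(2 * l) * y)
    _ = (√(2 * Real.pi))⁻¹ * Real.exp (-(1 / 2 - l * c) * y ^ 2) := by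
        rw [mul_assoc, ← Real.exp_add, mul_pow, Real.sq_sqrt (by positivity)]
        ring_nf

lemma lintegral_exp_mul_sq_le_of_hasSubgaussianMGF [SFinite P] (hX : HasSubgaussianMGF X c P)
    (h0 : 0 ≤ l) (h1 : 2 * (l * c) < 1) :
    ∫⁻ ω, ENNReal.ofReal (Real.exp (l * X ω ^ 2)) ∂P ≤
      ENNReal.ofReal (√((1 - 2 * (l * c))⁻¹)) := by
  have hx : 0 < 1 / 2 - l * c := by linarith
  have h_swap (F : ℝ → ℝ → ENNReal) (hF : Measurable (Function.uncurry F)) :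
      ∫⁻ ω, (∫⁻ y, F (X ω) y) ∂P = ∫⁻ y, ∫⁻ ω, F (X ω) y ∂P :=
    lintegral_lintegral_swap
      (hF.comp_aemeasurable (hX.aemeasurable.comp_fst.prodMk measurable_snd.aemeasurable))
  calc ∫⁻ ω, ENNReal.ofReal (Real.exp (l * X ω ^ 2)) ∂P
      = ∫⁻ y : ℝ, ∫⁻ ω, ENNReal.ofReal
          ((√(2 * Real.pi))⁻¹ * Real.exp (-(y ^ 2 / 2) + √(2 * l) * X ω * y)) ∂P := by
        simp only [ofReal_exp_mul_sq_eq_lintegral h0]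
        refine h_swap (fun x y => ENNReal.ofReal
          ((√(2 * Real.pi))⁻¹ * Real.exp (-(y ^ 2 / 2) + √(2 * l) * x * y))) ?_
        simp only [Function.uncurry_def]
        fun_prop
    _ ≤ ∫⁻ y : ℝ, ENNReal.ofReal ((√(2 * Real.pi))⁻¹ * Real.exp (-(1 / 2 - l * c) * y ^ 2)) :=
        lintegral_mono (lintegral_gaussian_mul_exp_le_of_hasSubgaussianMGF hX h0)
    _ = ENNReal.ofReal (√((1 - 2 * (l * c))⁻¹)) := by
        rw [← ofReal_integral_eq_lintegral_ofReal ((integrable_exp_neg_mul_sq hx).const_mul _)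
          (ae_of_all _ fun y => by positivity), integral_const_mul, integral_gaussian,
          ← Real.sqrt_inv, ← Real.sqrt_mul (by positivity)]
        have := Real.pi_ne_zero
        have : 1 - 2 * (l * (c : ℝ)) ≠ 0 := by linarith
        congr 2
        field_simp

lemma integrable_exp_mul_sq_of_hasSubgaussianMGF [SFinite P] (hX : HasSubgaussianMGF X c P)
    (h0 : 0 ≤ l) (h1 : 2 * (l * c) < 1) : Integrable (fun ω => Real.exp (l * X ω ^ 2)) P := by
  have hX_meas := hX.aemeasurable
  refine (lintegral_ofReal_ne_top_iff_integrable (by fun_prop)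
    (ae_of_all _ fun ω => (Real.exp_pos _).le)).1 ?_
  exact ne_top_of_le_ne_top ENNReal.ofReal_ne_top
    (lintegral_exp_mul_sq_le_of_hasSubgaussianMGF hX h0 h1)

lemma mgf_sq_le_of_hasSubgaussianMGF [SFinite P] (hX : HasSubgaussianMGF X c P) (h0 : 0 ≤ l)
    (h1 : l * c ≤ 1 / 4) :
    mgf (fun ω => X ω ^ 2) P l ≤ Real.exp (l * c + 2 * (l * c) ^ 2) := by
  have h2 : 2 * (l * c) < 1 := by linarith
  calc mgf (fun ω => X ω ^ 2) P l
      ≤ √((1 - 2 * (l * c))⁻¹) := by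
        rw [mgf, ← ENNReal.ofReal_le_ofReal_iff (Real.sqrt_nonneg _),
          ofReal_integral_eq_lintegral_ofReal (integrable_exp_mul_sq_of_hasSubgaussianMGF hX h0 h2)
            (ae_of_all _ fun ω => (Real.exp_pos _).le)]
        exact lintegral_exp_mul_sq_le_of_hasSubgaussianMGF hX h0 h2
    _ ≤ √(Real.exp (l * c + 2 * (l * c) ^ 2) ^ 2) := by
        refine Real.sqrt_le_sqrt ((inv_one_sub_le_exp (by positivity) (by linarith)).trans_eq ?_)
        rw [← Real.exp_nat_mul]
        push_cast
        ring_nf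
    _ = Real.exp (l * c + 2 * (l * c) ^ 2) := Real.sqrt_sq (Real.exp_pos _).le

lemma integrable_pow_of_hasSubgaussianMGF (hX : HasSubgaussianMGF X c P) (p : ℕ) :
    Integrable (fun ω => X ω ^ p) P :=
  integrable_pow_of_mem_interior_integrableExpSet (by simp [hX.integrableExpSet_eq_univ]) p

lemma integral_pow_four_le_of_hasSubgaussianMGF [SFinite P] (hX : HasSubgaussianMGF X c P) :
    ∫ ω, X ω ^ 4 ∂P ≤ 64 * (c : ℝ) ^ 2 := by
  rcases eq_or_ne c 0 with rfl | hc
  · have hzero : ∀ᵐ ω ∂P, X ω ^ 4 = 0 := by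
      filter_upwards [hX.ae_eq_zero_of_hasSubgaussianMGF_zero] with ω hω
      simp [hω]
    simp [integral_congr_ae hzero]
  have hc0 : (0 : ℝ) < c := by exact_mod_cast pos_iff_ne_zero.2 hc
  have hlc : 1 / (4 * (c : ℝ)) * c = 1 / 4 := by field_simp
  have hpt (ω : Ω) : X ω ^ 4 ≤ 32 * c ^ 2 * Real.exp (1 / (4 * c) * X ω ^ 2) := by
    have hquad := Real.quadratic_le_exp_of_nonneg (x := 1 / (4 * c) * X ω ^ 2) (by positivity)
    have hsq : (1 / (4 * c) * X ω ^ 2) ^ 2 ≤ 2 * Real.exp (1 / (4 * c) * X ω ^ 2) := by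
      have : 0 ≤ 1 / (4 * c) * X ω ^ 2 := by positivity
      linarith
    calc X ω ^ 4 = 16 * c ^ 2 * (1 / (4 * c) * X ω ^ 2) ^ 2 := by field_simp; ring
      _ ≤ 16 * c ^ 2 * (2 * Real.exp (1 / (4 * c) * X ω ^ 2)) := by gcongr
      _ = _ := by ring
  have hexp : Real.exp (1 / 4 + 2 * (1 / 4) ^ 2) ≤ 2 := by
    rw [← Real.le_log_iff_exp_le (by norm_num)]
    linarith [Real.log_two_gt_d9]
  have hmgf := mgf_sq_le_of_hasSubgaussianMGF hX (l := 1 / (4 * c)) (by positivity) hlc.le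
  rw [hlc] at hmgf
  have hint : Integrable (fun ω => Real.exp (1 / (4 * c) * X ω ^ 2)) P :=
    integrable_exp_mul_sq_of_hasSubgaussianMGF hX (by positivity) (by rw [hlc]; norm_num)
  calc ∫ ω, X ω ^ 4 ∂P
      ≤ ∫ ω, 32 * c ^ 2 * Real.exp (1 / (4 * c) * X ω ^ 2) ∂P :=
        integral_mono_of_nonneg (ae_of_all _ fun ω => by positivity) (hint.const_mul _)
          (ae_of_all _ hpt)
    _ ≤ 32 * c ^ 2 * 2 := by
        rw [integral_const_mul]
        exact mul_le_mul_of_nonneg_left (hmgf.trans hexp) (by positivity)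
    _ = 64 * (c : ℝ) ^ 2 := by ring

lemma mgf_sq_neg_le_of_hasSubgaussianMGF [IsProbabilityMeasure P] (hX : HasSubgaussianMGF X c P)
    (hvar : ∫ ω, X ω ^ 2 ∂P = c) (h0 : 0 ≤ l) :
    mgf (fun ω => X ω ^ 2) P (-l) ≤ Real.exp (-(l * c) + 32 * (l * c) ^ 2) := by
  have hint2 : Integrable (fun ω => 1 - l * X ω ^ 2) P :=
    (integrable_const 1).sub ((integrable_pow_of_hasSubgaussianMGF hX 2).const_mul l)
  have hint4 : Integrable (fun ω => l ^ 2 / 2 * X ω ^ 4) P :=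
    (integrable_pow_of_hasSubgaussianMGF hX 4).const_mul _
  calc mgf (fun ω => X ω ^ 2) P (-l)
      ≤ ∫ ω, (1 - l * X ω ^ 2 + l ^ 2 / 2 * X ω ^ 4) ∂P := by
        refine integral_mono_of_nonneg (ae_of_all _ fun ω => (Real.exp_pos _).le)
          (hint2.add hint4) (ae_of_all _ fun ω => ?_)
        dsimp only
        rw [neg_mul]
        exact (exp_neg_le_quadratic (by positivity)).trans_eq (by ring)
    _ = 1 - l * c + l ^ 2 / 2 * ∫ ω, X ω ^ 4 ∂P := by
        rw [integral_add hint2 hint4, integral_sub (integrable_const _)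
          ((integrable_pow_of_hasSubgaussianMGF hX 2).const_mul _), integral_const_mul,
          integral_const_mul, hvar]
        simp
    _ ≤ 1 - l * c + l ^ 2 / 2 * (64 * (c : ℝ) ^ 2) := by
        gcongr
        exact integral_pow_four_le_of_hasSubgaussianMGF hX
    _ = -(l * c) + 32 * (l * c) ^ 2 + 1 := by ring
    _ ≤ Real.exp (-(l * c) + 32 * (l * c) ^ 2) := Real.add_one_le_exp _

end Subgaussian

section Chernoff

variable {Ω ι : Type*} [MeasurableSpace Ω] [Fintype ι] {P : Measure Ω} [IsProbabilityMeasure P]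
  {X : Ω → ℝ} {t b : ℝ}

lemma integrable_exp_mul_sum_pi (hX : Integrable (fun ω => Real.exp (t * X ω)) P) :
    Integrable (fun x : ι → Ω => Real.exp (t * ∑ i, X (x i))) (Measure.pi fun _ => P) := by
  simp only [Finset.mul_sum, Real.exp_sum]
  exact .fintype_prod fun _ => hX

lemma mgf_sum_pi :
    mgf (fun x : ι → Ω => ∑ i, X (x i)) (Measure.pi fun _ => P) t =
      mgf X P t ^ Fintype.card ι := by
  simp only [mgf, Finset.mul_sum, Real.exp_sum]
  exact integral_fintype_prod_eq_pow fun ω => Real.exp (t * X ω)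

lemma pi_measureReal_ge_le_exp (ht : 0 ≤ t) (hX : Integrable (fun ω => Real.exp (t * X ω)) P)
    (hb : mgf X P t ≤ Real.exp b) (a : ℝ) :
    (Measure.pi fun _ : ι => P).real {x | Fintype.card ι * a ≤ ∑ i, X (x i)} ≤
      Real.exp (-(Fintype.card ι * (t * a - b))) := by
  calc _ ≤ Real.exp (-t * (Fintype.card ι * a)) * mgf X P t ^ Fintype.card ι := by
        rw [← mgf_sum_pi]
        exact measure_ge_le_exp_mul_mgf _ ht (integrable_exp_mul_sum_pi hX)
    _ ≤ Real.exp (-t * (Fintype.card ι * a)) * Real.exp b ^ Fintype.card ι := by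
        gcongr
        exact mgf_nonneg
    _ = Real.exp (-(Fintype.card ι * (t * a - b))) := by
        rw [← Real.exp_nat_mul, ← Real.exp_add]
        ring_nf

lemma pi_measureReal_le_le_exp (ht : 0 ≤ t) (hX : Integrable (fun ω => Real.exp (-t * X ω)) P)
    (hb : mgf X P (-t) ≤ Real.exp b) (a : ℝ) :
    (Measure.pi fun _ : ι => P).real {x | ∑ i, X (x i) ≤ Fintype.card ι * a} ≤
      Real.exp (-(Fintype.card ι * (-(t * a) - b))) := by
  have h := pi_measureReal_ge_le_exp (ι := ι) (X := fun ω => -X ω) ht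
    (by simpa only [neg_mul, mul_neg] using hX) (by rw [← mgf_neg] at hb; exact hb) (-a)
  simpa only [Finset.sum_neg_distrib, mul_neg, neg_le_neg_iff] using h

end Chernoff

/-! ### Sums of spins invariant under reversal -/

namespace FlipInvariant

variable {n : ℕ} {P : Measure (Config n)} [IsProbabilityMeasure P] {T : Finset (Fin n)}

lemma mgf_spinSum (hP : FlipInvariant P T) (t : ℝ) :
    mgf (spinSum T) P t = Real.cosh t ^ T.card := by
  simpa [mgf] using hP.integral_mul_exp_mul_spinSum (G := fun _ => 1) (t := fun _ => t)
    (fun _ _ _ => rfl) fun _ _ _ => rfl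

lemma hasSubgaussianMGF_spinSum (hP : FlipInvariant P T) :
    HasSubgaussianMGF (spinSum T) T.card P where
  integrable_exp_mul _ := .of_finite
  mgf_le t := by
    rw [hP.mgf_spinSum, NNReal.coe_natCast, mul_div_assoc, Real.exp_nat_mul]
    exact pow_le_pow_left₀ (Real.cosh_pos t).le (Real.cosh_le_exp_half_sq t) _

lemma integral_spinSum_sq (hP : FlipInvariant P T) : ∫ σ, spinSum T σ ^ 2 ∂P = T.card := by
  induction T using Finset.induction_on with
  | empty => simp [spinSum]
  | insert j T hjT ih =>
    have hsq (σ : Config n) : spinSum (insert j T) σ ^ 2 =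
        1 + 2 * (spin (σ j) * spinSum T σ) + spinSum T σ ^ 2 := by
      rw [spinSum_insert hjT, ← spin_sq (σ j)]
      ring
    simp only [hsq]
    rw [integral_add .of_finite .of_finite, integral_add .of_finite .of_finite,
      integral_const_mul, ih (hP.mono (Finset.subset_insert j T)),
      hP.integral_spin_mul (Finset.mem_insert_self j T) (spinSum_flipAt_of_notMem hjT),
      Finset.card_insert_of_notMem hjT]
    simp
    ring

end FlipInvariant

/-! ### Tails of the test statistics -/

lemma pairStat_eq {n : ℕ} (S : Finset (Fin n)) (σ : Config n) :
    pairStat S σ = spinSum S σ ^ 2 / S.card := by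
  rw [pairStat, sq, spinSum, Finset.sum_mul_sum, one_div_mul_eq_div]

lemma pairStat_nonneg {n : ℕ} (S : Finset (Fin n)) (σ : Config n) : 0 ≤ pairStat S σ := by
  rw [pairStat_eq]
  positivity

lemma cosh_pow_le_exp (a : ℝ) (d : ℕ) : Real.cosh a ^ d ≤ Real.exp (d * (a ^ 2 / 2)) := by
  rw [Real.exp_nat_mul]
  exact pow_le_pow_left₀ (Real.cosh_pos a).le (Real.cosh_le_exp_half_sq a) d

section Tails

variable {n : ℕ} {P : Measure (Config n)} [IsProbabilityMeasure P] {S T : Finset (Fin n)}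

lemma FlipInvariant.pi_spinSum_sq_ge_le_exp (hP : FlipInvariant P T) {u v : ℝ} (hu : 0 ≤ u)
    (huv : u ≤ v) (hv : T.card ≤ v) (m : ℕ) :
    (Measure.pi fun _ : Fin m => P).real {x | m * (T.card + u) ≤ ∑ l, spinSum T (x l) ^ 2} ≤
      Real.exp (-(m * (u ^ 2 / (8 * v ^ 2)))) := by
  rcases (hu.trans huv).eq_or_lt with rfl | hv0
  · simp
  set t := u / (4 * v ^ 2)
  have ht : 0 ≤ t := by positivity
  have htv : t * v = u / (4 * v) := by simp only [t]; field_simp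
  have htT : t * T.card ≤ u / (4 * v) := htv ▸ mul_le_mul_of_nonneg_left hv ht
  have htT4 : t * T.card ≤ 1 / 4 := htT.trans (by rw [div_le_iff₀ (by positivity)]; linarith)
  have hmgf := mgf_sq_le_of_hasSubgaussianMGF hP.hasSubgaussianMGF_spinSum ht htT4
  have h := pi_measureReal_ge_le_exp (ι := Fin m) ht .of_finite hmgf (T.card + u)
  rw [Fintype.card_fin] at h
  refine h.trans (Real.exp_le_exp.2 (neg_le_neg (mul_le_mul_of_nonneg_left ?_ m.cast_nonneg)))
  calc u ^ 2 / (8 * v ^ 2) = t * u - 2 * (u / (4 * v)) ^ 2 := by simp only [t]; field_simp; ring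
    _ ≤ t * u - 2 * (t * T.card) ^ 2 := by gcongr
    _ = t * (T.card + u) - (t * (T.card : NNReal) + 2 * (t * (T.card : NNReal)) ^ 2) := by
        rw [NNReal.coe_natCast]
        ring

lemma FlipInvariant.pi_spinSum_sq_le_le_exp (hP : FlipInvariant P T) {u v : ℝ} (hu : 0 ≤ u)
    (hv0 : 0 < v) (hv : T.card ≤ v) (m : ℕ) :
    (Measure.pi fun _ : Fin m => P).real {x | ∑ l, spinSum T (x l) ^ 2 ≤ m * (T.card - u)} ≤
      Real.exp (-(m * (u ^ 2 / (128 * v ^ 2)))) := by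
  set t := u / (64 * v ^ 2)
  have ht : 0 ≤ t := by positivity
  have htT : t * T.card ≤ u / (64 * v) :=
    (mul_le_mul_of_nonneg_left hv ht).trans_eq (by simp only [t]; field_simp)
  have hmgf := mgf_sq_neg_le_of_hasSubgaussianMGF hP.hasSubgaussianMGF_spinSum
    (by simp [hP.integral_spinSum_sq]) ht
  have h := pi_measureReal_le_le_exp (ι := Fin m) ht .of_finite hmgf (T.card - u)
  rw [Fintype.card_fin] at h
  refine h.trans (Real.exp_le_exp.2 (neg_le_neg (mul_le_mul_of_nonneg_left ?_ m.cast_nonneg)))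
  calc u ^ 2 / (128 * v ^ 2) = t * u - 32 * (u / (64 * v)) ^ 2 := by
        simp only [t]; field_simp; ring
    _ ≤ t * u - 32 * (t * T.card) ^ 2 := by gcongr
    _ = -(t * (T.card - u)) - (-(t * (T.card : NNReal)) + 32 * (t * (T.card : NNReal)) ^ 2) := by
        rw [NNReal.coe_natCast]
        ring

/-- `W_S + 2 M N / |S|`, where `M` and `N` are the sums of the spins in `S` and in `T`. If `T` is
the complement of `S`, this is the part of `(∑ i, σ i) ^ 2 / |S|` that involves spins in `S`. -/
def crossStat (S T : Finset (Fin n)) (σ : Config n) : ℝ :=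
  pairStat S σ + 2 * spinSum S σ * spinSum T σ / S.card

lemma FlipInvariant.mgf_crossStat (hP : FlipInvariant P T) (hST : Disjoint S T) (l : ℝ) :
    mgf (crossStat S T) P (-l) = ∫ σ, Real.exp (-(l * pairStat S σ)) *
      Real.cosh (2 * l * spinSum S σ / S.card) ^ T.card ∂P := by
  have hS (j : Fin n) (hj : j ∈ T) (σ : Config n) : spinSum S (flipAt j σ) = spinSum S σ :=
    spinSum_flipAt_of_notMem (Finset.disjoint_right.1 hST hj) σ
  have h := hP.integral_mul_exp_mul_spinSum
    (G := fun σ => Real.exp (-(l * pairStat S σ))) (t := fun σ => -(2 * l * spinSum S σ / S.card))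
    (fun j hj σ => by simp only [pairStat_eq, hS j hj]) fun j hj σ => by simp only [hS j hj]
  simp only [Real.cosh_neg] at h
  rw [← h, mgf]
  refine integral_congr_ae (ae_of_all _ fun σ => ?_)
  simp only [← Real.exp_add, crossStat]
  ring_nf

lemma exp_neg_pairStat_mul_cosh_pow_le {B R c : ℝ} (hB : 0 ≤ B) (hR : 0 < R) (hc0 : 0 ≤ c)
    (hc1 : c ≤ 1 / 2) (hS : S.Nonempty) (hT : (T.card : ℝ) ≤ R * S.card) (σ : Config n) :
    Real.exp (-(c / R * pairStat S σ)) *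
        Real.cosh (2 * (c / R) * spinSum S σ / S.card) ^ T.card ≤
      1 - c / R * (1 - 2 * c) * min (pairStat S σ) B + (c / R * B) ^ 2 / 2 := by
  have hk : (0 : ℝ) < S.card := by exact_mod_cast hS.card_pos
  have hW := pairStat_nonneg S σ
  set l := c / R with hl
  set W := pairStat S σ with hW_def
  set p := l * (1 - 2 * c)
  have hl0 : 0 ≤ l := by positivity
  have hp0 : 0 ≤ p := mul_nonneg hl0 (by linarith)
  have hpl : p ≤ l := mul_le_of_le_one_right hl0 (by linarith)
  have hmin : 0 ≤ min W B := le_min hW hB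
  have hcosh : Real.cosh (2 * l * spinSum S σ / S.card) ^ T.card ≤ Real.exp (2 * c * l * W) := by
    refine (cosh_pow_le_exp _ _).trans (Real.exp_le_exp.2 ?_)
    calc (T.card : ℝ) * ((2 * l * spinSum S σ / S.card) ^ 2 / 2)
        ≤ R * S.card * ((2 * l * spinSum S σ / S.card) ^ 2 / 2) := by gcongr
      _ = 2 * c * l * W := by rw [hW_def, pairStat_eq, hl]; field_simp
  calc _ ≤ Real.exp (-(l * W)) * Real.exp (2 * c * l * W) := by gcongr
    _ = Real.exp (-(p * W)) := by rw [← Real.exp_add]; simp only [p]; ring_nf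
    _ ≤ Real.exp (-(p * min W B)) := by gcongr; exact min_le_left _ _
    _ ≤ 1 - p * min W B + (p * min W B) ^ 2 / 2 := exp_neg_le_quadratic (by positivity)
    _ ≤ 1 - p * min W B + (l * B) ^ 2 / 2 := by gcongr; exact min_le_right _ _

lemma FlipInvariant.mgf_crossStat_le (hP : FlipInvariant P T) (hST : Disjoint S T)
    (hS : S.Nonempty) {a B η R c : ℝ} (hB : 0 ≤ B) (hR : 1 ≤ R) (hT : (T.card : ℝ) ≤ R * S.card)
    (hc0 : 0 ≤ c) (hc1 : c ≤ 1 / 2) (hcη : c * (4 * B + B ^ 2) ≤ η)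
    (ha : a + η ≤ ∫ σ, min (pairStat S σ) B ∂P) :
    mgf (crossStat S T) P (-(c / R)) ≤ Real.exp (-(c / R * (a + η / 2))) := by
  set w := ∫ σ, min (pairStat S σ) B ∂P
  set l := c / R
  have hl0 : 0 ≤ l := by positivity
  have hlc : l ≤ c := div_le_self hc0 hR
  have hwB : w ≤ B := by
    simpa using integral_mono (μ := P) (g := fun _ => B) .of_finite .of_finite
      fun σ => min_le_right (pairStat S σ) B
  calc mgf (crossStat S T) P (-l)
      ≤ ∫ σ, (1 - l * (1 - 2 * c) * min (pairStat S σ) B + (l * B) ^ 2 / 2) ∂P := by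
        rw [hP.mgf_crossStat hST]
        exact integral_mono .of_finite .of_finite fun σ =>
          exp_neg_pairStat_mul_cosh_pow_le hB (by linarith) hc0 hc1 hS hT σ
    _ = 1 - l * (1 - 2 * c) * w + (l * B) ^ 2 / 2 := by
        rw [integral_add .of_finite .of_finite, integral_sub .of_finite .of_finite,
          integral_const_mul]
        simp [w]
    _ ≤ -(l * (a + η / 2)) + 1 := by
        have hlB : l * B ^ 2 ≤ c * B ^ 2 := by gcongr
        have hcw : c * w ≤ c * B := by gcongr
        nlinarith [mul_le_mul_of_nonneg_left hlB hl0, mul_le_mul_of_nonneg_left hcw hl0,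
          mul_le_mul_of_nonneg_left hcη hl0, mul_le_mul_of_nonneg_left ha hl0]
    _ ≤ Real.exp (-(l * (a + η / 2))) := Real.add_one_le_exp _

lemma FlipInvariant.pi_crossStat_le_le_exp (hP : FlipInvariant P T) (hST : Disjoint S T)
    (hS : S.Nonempty) {a B η R c : ℝ} (hB : 0 ≤ B) (hR : 1 ≤ R) (hT : (T.card : ℝ) ≤ R * S.card)
    (hc0 : 0 ≤ c) (hc1 : c ≤ 1 / 2) (hcη : c * (4 * B + B ^ 2) ≤ η)
    (ha : a + η ≤ ∫ σ, min (pairStat S σ) B ∂P) (m : ℕ) :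
    (Measure.pi fun _ : Fin m => P).real {x | ∑ l, crossStat S T (x l) ≤ m * a} ≤
      Real.exp (-(m * (c * η / (2 * R)))) := by
  have hmgf := hP.mgf_crossStat_le hST hS hB hR hT hc0 hc1 hcη ha
  have h := pi_measureReal_le_le_exp (ι := Fin m) (by positivity) .of_finite hmgf a
  rw [Fintype.card_fin] at h
  convert h using 4
  ring

end Tails

/-! ### Risk of the tests -/

/-- Along cliques `S` with `|S| → ∞`, a truncated mean of `W_S` eventually exceeds `1 + τ` by a
fixed amount. -/
def TruncatedMeanExceeds (μ : Measure ℝ) (θ τ : ℝ) : Prop :=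
  ∃ B η : ℝ, 0 < B ∧ 0 < η ∧ ∃ K : ℕ, ∀ (n : ℕ) (S : Finset (Fin n)), K ≤ S.card →
    1 + τ + 2 * η ≤ ∫ σ, min (pairStat S σ) B ∂(plantedLaw μ θ S)

lemma exists_forall_exp_neg_le {a δ : ℝ} (ha : 0 < a) (hδ : 0 < δ) :
    ∃ C : ℝ, 0 < C ∧ ∀ x, C ≤ x → Real.exp (-(a * x)) ≤ δ := by
  have h : Tendsto (fun x : ℝ => Real.exp (-(a * x))) atTop (𝓝 0) :=
    Real.tendsto_exp_neg_atTop_nhds_zero.comp (tendsto_id.const_mul_atTop ha)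
  obtain ⟨C, hC⟩ := eventually_atTop.1 (h.eventually_le_const hδ)
  exact ⟨max 1 C, by positivity, fun x hx => hC x ((le_max_right _ _).trans hx)⟩

lemma exists_pos_mul_le {b η : ℝ} (hb : 0 < b) (hη : 0 < η) :
    ∃ c : ℝ, 0 < c ∧ c ≤ 1 / 2 ∧ c * b ≤ η :=
  ⟨min (1 / 2) (η / b), by positivity, min_le_left _ _, (le_div_iff₀ hb).1 (min_le_right _ _)⟩

section ScanTest

variable {n k m : ℕ}

lemma half_le_localRate (hk : 0 < k) (hkn : 2 * k ≤ n) : (k : ℝ) / 2 ≤ localRate n k := by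
  have hk0 : (0 : ℝ) < k := by exact_mod_cast hk
  have hlog : 1 / 2 ≤ Real.log ((n : ℝ) / k) := by
    calc (1 : ℝ) / 2 ≤ Real.log 2 := by linarith [Real.log_two_gt_d9]
      _ ≤ _ := Real.log_le_log (by norm_num) (by rw [le_div_iff₀ hk0]; exact_mod_cast hkn)
  rw [localRate, div_eq_mul_one_div]
  gcongr

lemma choose_le_exp_localRate (hk : 0 < k) (hkn : 2 * k ≤ n) :
    (n.choose k : ℝ) ≤ Real.exp (3 * localRate n k) := by
  have hk0 : (0 : ℝ) < k := by exact_mod_cast hk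
  have hn0 : (0 : ℝ) < n := by exact_mod_cast (by lia : 0 < n)
  calc (n.choose k : ℝ) ≤ (n : ℝ) ^ k / k.factorial := Nat.choose_le_pow_div k n
    _ = (n / k : ℝ) ^ k * ((k : ℝ) ^ k / k.factorial) := by
        rw [div_pow]
        field_simp
    _ ≤ (n / k : ℝ) ^ k * Real.exp k := by
        gcongr
        exact Real.pow_div_factorial_le_exp _ hk0.le k
    _ = Real.exp (localRate n k + k) := by
        rw [Real.exp_add, localRate, Real.exp_nat_mul, Real.exp_log (by positivity)]
    _ ≤ Real.exp (3 * localRate n k) := by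
        gcongr
        linarith [half_le_localRate hk hkn]

lemma localStat_eq {S : Finset (Fin n)} (hS : S.Nonempty) (x : Fin m → Config n) :
    localStat S x = (∑ l, pairStat S (x l)) / m - 1 := by
  have hk : (S.card : ℝ) ≠ 0 := by exact_mod_cast hS.card_pos.ne'
  have hsum : ∑ i ∈ S, ∑ j ∈ S, ∑ l, spin (x l i) * spin (x l j) = ∑ l, spinSum S (x l) ^ 2 := by
    simp only [spinSum, sq, Finset.sum_mul_sum]
    exact (Finset.sum_congr rfl fun i _ => Finset.sum_comm).trans Finset.sum_comm
  rw [localStat]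
  simp only [← Finset.mul_sum, hsum, pairStat_eq, ← Finset.sum_div]
  field_simp

lemma scanStat_attained (hk : k ≤ n) (x : Fin m → Config n) :
    ∃ S : Finset (Fin n), S.card = k ∧ scanStat k x = localStat S x := by
  obtain ⟨S₀, -, hS₀⟩ := Finset.exists_subset_card_eq (s := Finset.univ (α := Fin n))
    (by simpa using hk)
  have : Nonempty {S : Finset (Fin n) // S.card = k} := ⟨⟨S₀, hS₀⟩⟩
  obtain ⟨S, hS⟩ := exists_eq_ciSup_of_finite
    (f := fun S : {S : Finset (Fin n) // S.card = k} => localStat S.1 x)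
  exact ⟨S.1, S.2, hS.symm⟩

lemma localStat_le_scanStat (S : Finset (Fin n)) (x : Fin m → Config n) :
    localStat S x ≤ scanStat S.card x :=
  le_ciSup (f := fun S' : {S' : Finset (Fin n) // S'.card = S.card} => localStat S'.1 x)
    (Set.finite_range _).bddAbove ⟨S, rfl⟩

lemma scanTest_subset {τ : ℝ} (hk : 0 < k) (hkn : k ≤ n) (hm : 0 < m) :
    scanTest n m k τ ⊆ ⋃ S ∈ Finset.powersetCard k Finset.univ,
      {x | m * (S.card + k * τ) ≤ ∑ l, spinSum S (x l) ^ 2} := by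
  intro x hx
  obtain ⟨S, rfl, hS⟩ := scanStat_attained hkn x
  have hk0 : (0 : ℝ) < S.card := by exact_mod_cast hk
  have hm0 : (0 : ℝ) < m := by exact_mod_cast hm
  simp only [Set.mem_iUnion]
  refine ⟨S, Finset.mem_powersetCard.2 ⟨Finset.subset_univ _, rfl⟩, ?_⟩
  have hτ : τ ≤ localStat S x := hS ▸ hx
  rw [localStat_eq (Finset.card_pos.1 hk)] at hτ
  simp only [pairStat_eq, ← Finset.sum_div] at hτ
  rw [le_sub_iff_add_le, le_div_iff₀ hm0, le_div_iff₀ hk0] at hτ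
  exact (by ring : (m : ℝ) * (S.card + S.card * τ) = (τ + 1) * m * S.card).trans_le hτ

lemma measureReal_biUnion_le_card_mul {Ω ι : Type*} [MeasurableSpace Ω] {P : Measure Ω}
    {s : Finset ι} {E : ι → Set Ω} {b : ℝ} (hE : ∀ i ∈ s, P.real (E i) ≤ b) :
    P.real (⋃ i ∈ s, E i) ≤ s.card * b :=
  (measureReal_biUnion_finset_le s E).trans ((Finset.sum_le_card_nsmul s _ b hE).trans_eq
    (nsmul_eq_mul _ _))

lemma nullLaw_scanTest_le {μ : Measure ℝ} [IsProbabilityMeasure μ]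
    (hsymm : μ.map (fun h => -h) = μ) {τ s : ℝ} (hs0 : 0 ≤ s) (hs1 : s ≤ 1) (hsτ : s ≤ τ)
    (hm : 0 < m) (hk : 0 < k) (hkn : k ≤ n) :
    (Measure.pi fun _ : Fin m => nullLaw n μ).real (scanTest n m k τ) ≤
      n.choose k * Real.exp (-(m * (s ^ 2 / 8))) := by
  have hk0 : (0 : ℝ) < k := by exact_mod_cast hk
  have htail (S : Finset (Fin n)) (hS : S ∈ Finset.powersetCard k Finset.univ) :
      (Measure.pi fun _ : Fin m => nullLaw n μ).real
        {x | m * (S.card + k * s) ≤ ∑ l, spinSum S (x l) ^ 2} ≤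
        Real.exp (-(m * (s ^ 2 / 8))) := by
    have h := (flipInvariant_nullLaw hsymm S).pi_spinSum_sq_ge_le_exp (u := k * s) (v := k)
      (by positivity) (mul_le_of_le_one_right hk0.le hs1)
      (by rw [(Finset.mem_powersetCard.1 hS).2]) m
    rwa [mul_pow, mul_comm 8, mul_div_mul_left _ _ (by positivity)] at h
  have hunion := measureReal_biUnion_le_card_mul htail
  rw [Finset.card_powersetCard, Finset.card_univ, Fintype.card_fin] at hunion
  refine (measureReal_mono (fun x (hx : τ ≤ scanStat k x) => ?_) (measure_ne_top _ _)).trans hunion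
  exact scanTest_subset hk hkn hm (hsτ.trans hx)

lemma nullLaw_scanTest_le_exp_neg_localRate {μ : Measure ℝ} [IsProbabilityMeasure μ]
    (hsymm : μ.map (fun h => -h) = μ) {τ s : ℝ} (hs0 : 0 < s) (hs1 : s ≤ 1) (hsτ : s ≤ τ)
    (hm : 0 < m) (hk : 0 < k) (hkn : 2 * k ≤ n) (hrate : 32 / s ^ 2 * localRate n k ≤ m) :
    (Measure.pi fun _ : Fin m => nullLaw n μ).real (scanTest n m k τ) ≤
      Real.exp (-localRate n k) :=
  calc _ ≤ n.choose k * Real.exp (-(m * (s ^ 2 / 8))) :=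
        nullLaw_scanTest_le hsymm hs0.le hs1 hsτ hm hk (by lia)
    _ ≤ Real.exp (3 * localRate n k) * Real.exp (-(32 / s ^ 2 * localRate n k * (s ^ 2 / 8))) := by
        gcongr
        exact choose_le_exp_localRate hk hkn
    _ = Real.exp (-localRate n k) := by
        rw [← Real.exp_add]
        congr 1
        field_simp
        ring

lemma plantedLaw_scanTest_compl_le {μ : Measure ℝ} [IsProbabilityMeasure μ]
    (hsymm : μ.map (fun h => -h) = μ) {θ τ B η c : ℝ} (hB : 0 ≤ B) (hη : 0 ≤ η)
    (hc0 : 0 ≤ c) (hc1 : c ≤ 1 / 2) (hcη : c * (4 * B + B ^ 2) ≤ η) (hm : 0 < m)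
    {S : Finset (Fin n)} (hS : S.Nonempty)
    (hmean : 1 + τ + 2 * η ≤ ∫ σ, min (pairStat S σ) B ∂(plantedLaw μ θ S)) :
    (Measure.pi fun _ : Fin m => plantedLaw μ θ S).real (scanTest n m S.card τ)ᶜ ≤
      Real.exp (-(m * (c * η / 2))) := by
  have hm0 : (0 : ℝ) < m := by exact_mod_cast hm
  have htail := (flipInvariant_plantedLaw hsymm θ (Finset.disjoint_empty_right S)
    ).pi_crossStat_le_le_exp (a := 1 + τ) (Finset.disjoint_empty_right S) hS hB le_rfl (by simp)
    hc0 hc1 hcη (by linarith) m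
  rw [mul_one] at htail
  refine (measureReal_mono fun x hx => ?_).trans htail
  have hlt : localStat S x < τ := (localStat_le_scanStat S x).trans_lt (not_le.1 hx)
  rw [localStat_eq hS, sub_lt_iff_lt_add', div_lt_iff₀ hm0, mul_comm] at hlt
  simpa [crossStat, spinSum] using hlt.le

theorem scanTestSucceeds_of_truncatedMeanExceeds {μ : Measure ℝ} [IsProbabilityMeasure μ]
    (hsymm : μ.map (fun h => -h) = μ) {θ τ : ℝ} (hτ : 0 < τ)
    (h : TruncatedMeanExceeds μ θ τ) : ScanTestSucceeds μ θ τ := by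
  obtain ⟨B, η, hB, hη, K, hK⟩ := h
  obtain ⟨c, hc0, hc1, hcη⟩ := exists_pos_mul_le (b := 4 * B + B ^ 2) (by positivity) hη
  set s := min 1 τ
  have hs0 : 0 < s := by positivity
  set C := 32 / s ^ 2
  have hC0 : 0 < C := by positivity
  refine ⟨C, hC0, fun δ hδ => ?_⟩
  obtain ⟨K₁, -, hK₁⟩ := exists_forall_exp_neg_le (a := 1 / 2) (by norm_num) (half_pos hδ)
  obtain ⟨K₂, -, hK₂⟩ := exists_forall_exp_neg_le (a := C / 2 * (c * η / 2)) (by positivity)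
    (half_pos hδ)
  refine ⟨max K (max 1 (max ⌈K₁⌉₊ ⌈K₂⌉₊)), fun n m S hcard hkn hm => ?_⟩
  simp only [max_le_iff, Nat.ceil_le] at hcard
  obtain ⟨hSK, hS1, hSK₁, hSK₂⟩ := hcard
  have hrate := half_le_localRate hS1 hkn
  have hmk : C / 2 * S.card ≤ m := by linarith [mul_le_mul_of_nonneg_left hrate hC0.le]
  have hm0 : 0 < m := by
    have : (0 : ℝ) < S.card := by exact_mod_cast hS1
    exact_mod_cast (by positivity : 0 < C / 2 * (S.card : ℝ)).trans_le hmk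
  have h_typeI : (Measure.pi fun _ : Fin m => nullLaw n μ).real (scanTest n m S.card τ) ≤ δ / 2 :=
    calc _ ≤ Real.exp (-localRate n S.card) := nullLaw_scanTest_le_exp_neg_localRate hsymm hs0
          (min_le_left _ _) (min_le_right _ _) hm0 hS1 hkn hm
      _ ≤ Real.exp (-(1 / 2 * S.card)) := by gcongr; linarith
      _ ≤ δ / 2 := hK₁ _ hSK₁
  have h_typeII : (Measure.pi fun _ : Fin m => plantedLaw μ θ S).real (scanTest n m S.card τ)ᶜ ≤
      δ / 2 :=
    calc _ ≤ Real.exp (-(m * (c * η / 2))) := plantedLaw_scanTest_compl_le hsymm hB.le hη.le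
          hc0.le hc1 hcη hm0 (Finset.card_pos.1 hS1) (hK n S hSK)
      _ ≤ Real.exp (-(C / 2 * (c * η / 2) * S.card)) := by
          rw [mul_right_comm]
          gcongr
      _ ≤ δ / 2 := hK₂ _ hSK₂
  unfold risk
  linarith

end ScanTest

section GlobalTest

variable {n k m : ℕ}

lemma le_globalStat_iff {τ : ℝ} (hk : 0 < k) (hm : 0 < m) (x : Fin m → Config n) :
    τ ≤ globalStat k x ↔ m * (n + k * τ) ≤ ∑ l, spinSum Finset.univ (x l) ^ 2 := by
  have hk0 : (0 : ℝ) < k := by exact_mod_cast hk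
  have hm0 : (0 : ℝ) < m := by exact_mod_cast hm
  rw [globalStat, one_div_mul_eq_div, one_div_mul_eq_div, le_div_iff₀ hk0, le_sub_iff_add_le,
    le_div_iff₀ hm0]
  ring_nf

lemma nullLaw_globalTest_le {μ : Measure ℝ} [IsProbabilityMeasure μ]
    (hsymm : μ.map (fun h => -h) = μ) {τ s : ℝ} (hs0 : 0 ≤ s) (hs1 : s ≤ 1) (hsτ : s ≤ τ)
    (hm : 0 < m) (hk : 0 < k) (hkn : k ≤ n) :
    (Measure.pi fun _ : Fin m => nullLaw n μ).real (globalTest n m k τ) ≤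
      Real.exp (-(s ^ 2 / 8 * (m / (n / k) ^ 2))) := by
  have hks : k * s ≤ n := (mul_le_of_le_one_right k.cast_nonneg hs1).trans (by exact_mod_cast hkn)
  have htail := (flipInvariant_nullLaw hsymm (Finset.univ (α := Fin n))).pi_spinSum_sq_ge_le_exp
    (u := k * s) (v := n) (by positivity) hks (by simp) m
  have hexp : (m : ℝ) * ((k * s) ^ 2 / (8 * n ^ 2)) = s ^ 2 / 8 * (m / (n / k) ^ 2) := by
    have : (k : ℝ) ≠ 0 := by exact_mod_cast hk.ne'
    have : (n : ℝ) ≠ 0 := by exact_mod_cast (hk.trans_le hkn).ne'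
    field_simp
  rw [hexp, Finset.card_univ, Fintype.card_fin] at htail
  refine (measureReal_mono fun x hx => ?_).trans htail
  exact (le_globalStat_iff hk hm x).1 (hsτ.trans hx)

lemma sum_spinSum_univ_sq {S : Finset (Fin n)} (hS : S.Nonempty) (x : Fin m → Config n) :
    ∑ l, spinSum Finset.univ (x l) ^ 2 =
      S.card * ∑ l, crossStat S Sᶜ (x l) + ∑ l, spinSum Sᶜ (x l) ^ 2 := by
  have hk : (S.card : ℝ) ≠ 0 := by exact_mod_cast hS.card_pos.ne'
  have hsplit (σ : Config n) : spinSum Finset.univ σ = spinSum S σ + spinSum Sᶜ σ :=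
    (Finset.sum_add_sum_compl S _).symm
  rw [Finset.mul_sum, ← Finset.sum_add_distrib]
  refine Finset.sum_congr rfl fun l _ => ?_
  rw [hsplit, crossStat, pairStat_eq]
  field_simp
  ring

lemma globalTest_compl_subset {S : Finset (Fin n)} (hS : S.Nonempty) (hm : 0 < m) (τ η : ℝ) :
    (globalTest n m S.card τ)ᶜ ⊆ {x | ∑ l, crossStat S Sᶜ (x l) ≤ m * (1 + τ + η)} ∪
      {x | ∑ l, spinSum Sᶜ (x l) ^ 2 ≤ m * ((Sᶜ.card : ℝ) - S.card * η)} := by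
  intro x hx
  have hk0 : (0 : ℝ) < S.card := by exact_mod_cast hS.card_pos
  have hlt := mt (le_globalStat_iff hS.card_pos hm x).2 hx
  rw [not_le, sum_spinSum_univ_sq hS] at hlt
  have hcard : (Sᶜ.card : ℝ) = n - S.card := by
    rw [Finset.card_compl, Fintype.card_fin, Nat.cast_sub (by simpa using S.card_le_univ)]
  by_contra hcon
  simp only [Set.mem_union, Set.mem_ofPred_eq, not_or, not_le, hcard] at hcon
  nlinarith [mul_lt_mul_of_pos_left hcon.1 hk0]

lemma plantedLaw_globalTest_compl_le {μ : Measure ℝ} [IsProbabilityMeasure μ]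
    (hsymm : μ.map (fun h => -h) = μ) {θ τ B η c : ℝ} (hB : 0 ≤ B) (hη : 0 ≤ η)
    (hc0 : 0 ≤ c) (hc1 : c ≤ 1 / 2) (hcη : c * (4 * B + B ^ 2) ≤ η) (hm : 0 < m)
    {S : Finset (Fin n)} (hS : S.Nonempty)
    (hmean : 1 + τ + 2 * η ≤ ∫ σ, min (pairStat S σ) B ∂(plantedLaw μ θ S)) :
    (Measure.pi fun _ : Fin m => plantedLaw μ θ S).real (globalTest n m S.card τ)ᶜ ≤
      Real.exp (-(c * η / 2 * (m / (n / S.card) ^ 2))) +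
        Real.exp (-(η ^ 2 / 128 * (m / (n / S.card) ^ 2))) := by
  have hk0 : (0 : ℝ) < S.card := by exact_mod_cast hS.card_pos
  have hkn : (S.card : ℝ) ≤ n := by exact_mod_cast (by simpa using S.card_le_univ)
  have hR : 1 ≤ (n : ℝ) / S.card := (one_le_div hk0).2 hkn
  have hT : (Sᶜ.card : ℝ) ≤ n := by exact_mod_cast (by simpa using Sᶜ.card_le_univ)
  have hflip := flipInvariant_plantedLaw hsymm θ (disjoint_compl_right (a := S))
  refine (measureReal_mono (globalTest_compl_subset hS hm τ η)).trans
    ((measureReal_union_le _ _).trans (add_le_add ?_ ?_))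
  · refine (hflip.pi_crossStat_le_le_exp disjoint_compl_right hS hB hR
      (by rwa [div_mul_cancel₀ _ hk0.ne']) hc0 hc1 hcη (by linarith) m).trans
        (Real.exp_le_exp.2 (neg_le_neg ?_))
    calc c * η / 2 * (m / (n / S.card) ^ 2) ≤ c * η / 2 * (m / (n / S.card)) := by
          gcongr
          exact le_self_pow₀ hR two_ne_zero
      _ = m * (c * η / (2 * (n / S.card))) := by field_simp
  · refine (hflip.pi_spinSum_sq_le_le_exp (v := n) (by positivity) (hk0.trans_le hkn) hT m
      ).trans_eq ?_
    congr 2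
    field_simp

theorem globalTestSucceeds_of_truncatedMeanExceeds {μ : Measure ℝ} [IsProbabilityMeasure μ]
    (hsymm : μ.map (fun h => -h) = μ) {θ τ : ℝ} (hτ : 0 < τ)
    (h : TruncatedMeanExceeds μ θ τ) : GlobalTestSucceeds μ θ τ := by
  obtain ⟨B, η, hB, hη, K, hK⟩ := h
  obtain ⟨c, hc0, hc1, hcη⟩ := exists_pos_mul_le (b := 4 * B + B ^ 2) (by positivity) hη
  set s := min 1 τ
  have hs0 : 0 < s := by positivity
  intro δ hδ
  have hδ3 : 0 < δ / 3 := by positivity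
  obtain ⟨C₁, hC₁0, hC₁⟩ := exists_forall_exp_neg_le (a := s ^ 2 / 8) (by positivity) hδ3
  obtain ⟨C₂, -, hC₂⟩ := exists_forall_exp_neg_le (a := c * η / 2) (by positivity) hδ3
  obtain ⟨C₃, -, hC₃⟩ := exists_forall_exp_neg_le (a := η ^ 2 / 128) (by positivity) hδ3
  refine ⟨max C₁ (max C₂ C₃), by positivity, max K 1, fun n m S hcard hm => ?_⟩
  obtain ⟨hSK, hS1⟩ := max_le_iff.1 hcard
  have hS : S.Nonempty := Finset.card_pos.1 hS1
  have hkn : S.card ≤ n := by simpa using S.card_le_univ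
  have hk0 : (0 : ℝ) < S.card := by exact_mod_cast hS1
  have hR0 : (0 : ℝ) < n / S.card := div_pos (hk0.trans_le (by exact_mod_cast hkn)) hk0
  rw [globalRate, ← div_pow] at hm
  have hm0 : 0 < m := by
    exact_mod_cast (by positivity : 0 < max C₁ (max C₂ C₃) * ((n : ℝ) / S.card) ^ 2).trans_le hm
  rw [← le_div_iff₀ (by positivity)] at hm
  simp only [max_le_iff] at hm
  have h_typeI := (nullLaw_globalTest_le (μ := μ) hsymm hs0.le (min_le_left 1 τ)
    (min_le_right 1 τ) hm0 hS1 hkn).trans (hC₁ _ hm.1)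
  have h_typeII := (plantedLaw_globalTest_compl_le (μ := μ) hsymm hB.le hη.le hc0.le hc1 hcη hm0 hS
    (hK n S hSK)).trans (add_le_add (hC₂ _ hm.2.1) (hC₃ _ hm.2.2))
  unfold risk
  linarith

end GlobalTest

lemma two_mul_le_of_pow_three_lt_sq {n k : ℕ} (hk : 4 ≤ k) (h : k ^ 3 < n ^ 2) : 2 * k ≤ n := by
  by_contra! hcon
  have hsq : n ^ 2 < (2 * k) ^ 2 := Nat.pow_lt_pow_left hcon two_ne_zero
  nlinarith [Nat.mul_le_mul_right (k ^ 2) hk]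

theorem ScanTestSucceeds.combinedTestSucceeds {μ : Measure ℝ} {θ τ : ℝ}
    (hs : ScanTestSucceeds μ θ τ) (hg : GlobalTestSucceeds μ θ τ) :
    CombinedTestSucceeds μ θ τ := by
  intro δ hδ
  obtain ⟨C₁, hC₁, hs⟩ := hs
  obtain ⟨K₁, hK₁⟩ := hs δ hδ
  obtain ⟨C₂, -, K₂, hK₂⟩ := hg δ hδ
  refine ⟨max C₁ C₂, by positivity, max 4 (max K₁ K₂), fun n m S hcard hm => ?_⟩
  simp only [max_le_iff] at hcard
  obtain ⟨hS4, hSK₁, hSK₂⟩ := hcard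
  unfold combinedTest
  split_ifs at hm ⊢ with hlt
  · have hkn := two_mul_le_of_pow_three_lt_sq hS4 hlt
    have hrate : 0 ≤ localRate n S.card :=
      (by positivity : 0 ≤ (S.card : ℝ) / 2).trans (half_le_localRate (by lia) hkn)
    exact hK₁ n m S hSK₁ hkn (le_trans (by gcongr; exact le_max_left _ _) hm)
  · have hrate : 0 ≤ globalRate n S.card := by unfold globalRate; positivity
    exact hK₂ n m S hSK₂ (le_trans (by gcongr; exact le_max_right _ _) hm)

/-! ### Tilted Gaussian densities -/

/-- The density of the standard Gaussian measure, without its constant, tilted by `exp L`. -/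
def tiltedDensity (L : ℝ → ℝ) (y : ℝ) : ℝ := Real.exp (-(y ^ 2 / 2) + L y)

/-- The exponents `L` used to tilt the Gaussian density: `L` vanishes at `0` and has a continuous
derivative `L'` bounded by `a`. -/
structure IsTilt (L L' : ℝ → ℝ) (a : ℝ) : Prop where
  hasDerivAt : ∀ y, HasDerivAt L (L' y) y
  continuous_deriv : Continuous L'
  abs_deriv_le : ∀ y, |L' y| ≤ a
  map_zero : L 0 = 0

lemma isTilt_linear (a : ℝ) : IsTilt (fun y => a * y) (fun _ => a) |a| where
  hasDerivAt y := by simpa using (hasDerivAt_id y).const_mul a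
  continuous_deriv := continuous_const
  abs_deriv_le _ := le_rfl
  map_zero := mul_zero a

lemma tiltedDensity_pos (L : ℝ → ℝ) (y : ℝ) : 0 < tiltedDensity L y := Real.exp_pos _

lemma one_add_pow_four_le_exp_abs (y : ℝ) : 1 + y ^ 4 ≤ 25 * Real.exp |y| := by
  have h := Real.pow_div_factorial_le_exp |y| (abs_nonneg y) 4
  rw [Even.pow_abs (by decide), show ((Nat.factorial 4 : ℕ) : ℝ) = 24 by norm_num [Nat.factorial]]
    at h
  linarith [Real.one_le_exp (abs_nonneg y)]

lemma abs_pow_le_one_add_pow_four (y : ℝ) {n : ℕ} (hn : n ≤ 4) : |y| ^ n ≤ 1 + y ^ 4 := by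
  rw [← Even.pow_abs (by decide : Even 4)]
  have h4 : 0 ≤ |y| ^ 4 := by positivity
  rcases le_total |y| 1 with h | h
  · linarith [pow_le_one₀ (n := n) (abs_nonneg y) h]
  · linarith [pow_le_pow_right₀ h hn]

namespace IsTilt

variable {L L' : ℝ → ℝ} {a : ℝ}

lemma le_mul_abs (h : IsTilt L L' a) (y : ℝ) : L y ≤ a * |y| := by
  have := convex_univ.norm_image_sub_le_of_norm_hasDerivWithin_le
    (fun x _ => (h.hasDerivAt x).hasDerivWithinAt) (fun x _ => h.abs_deriv_le x)
    (Set.mem_univ 0) (Set.mem_univ y)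
  rw [h.map_zero, sub_zero, sub_zero] at this
  exact (le_abs_self _).trans this

lemma continuous (h : IsTilt L L' a) : Continuous L :=
  continuous_iff_continuousAt.2 fun y => (h.hasDerivAt y).continuousAt

lemma continuous_density (h : IsTilt L L' a) : Continuous (tiltedDensity L) := by
  have := h.continuous
  unfold tiltedDensity
  fun_prop

lemma exp_abs_mul_density_le (h : IsTilt L L' a) (y : ℝ) :
    Real.exp |y| * tiltedDensity L y ≤
      Real.exp (-(y ^ 2 / 2) + (a + 1) * y) + Real.exp (-(y ^ 2 / 2) + -(a + 1) * y) := by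
  have hle : Real.exp |y| * tiltedDensity L y ≤ Real.exp (-(y ^ 2 / 2) + (a + 1) * |y|) := by
    rw [tiltedDensity, ← Real.exp_add]
    exact Real.exp_le_exp.2 (by linarith [h.le_mul_abs y])
  refine hle.trans ?_
  rcases abs_choice y with hy | hy <;> rw [hy]
  · exact le_add_of_nonneg_right (Real.exp_pos _).le
  · rw [mul_neg, ← neg_mul]
    exact le_add_of_nonneg_left (Real.exp_pos _).le

lemma integrable_mul (h : IsTilt L L' a) {g : ℝ → ℝ} (hg : Continuous g) {C : ℝ}
    (hC : ∀ y, |g y| ≤ C * (1 + y ^ 4)) : Integrable fun y => g y * tiltedDensity L y := by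
  have hC0 : 0 ≤ C := by simpa using (abs_nonneg _).trans (hC 0)
  refine Integrable.mono' (((integrable_exp_neg_half_sq_add_mul (a + 1)).add
    (integrable_exp_neg_half_sq_add_mul (-(a + 1)))).const_mul (C * 25))
    (hg.mul h.continuous_density).aestronglyMeasurable (ae_of_all _ fun y => ?_)
  have hρ := tiltedDensity_pos L y
  rw [norm_mul, Real.norm_eq_abs, Real.norm_of_nonneg hρ.le]
  calc |g y| * tiltedDensity L y ≤ C * (25 * Real.exp |y|) * tiltedDensity L y := by
        gcongr
        exact (hC y).trans (mul_le_mul_of_nonneg_left (one_add_pow_four_le_exp_abs y) hC0)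
    _ = C * 25 * (Real.exp |y| * tiltedDensity L y) := by ring
    _ ≤ _ := mul_le_mul_of_nonneg_left (h.exp_abs_mul_density_le y) (by positivity)

lemma integrable_pow (h : IsTilt L L' a) {n : ℕ} (hn : n ≤ 4) :
    Integrable fun y => y ^ n * tiltedDensity L y :=
  h.integrable_mul (C := 1) (by fun_prop) fun y => by
    rw [abs_pow, one_mul]
    exact abs_pow_le_one_add_pow_four y hn

lemma integrable_density (h : IsTilt L L' a) : Integrable (tiltedDensity L) := by
  simpa using h.integrable_pow (n := 0) (by norm_num)

lemma integrable_pow_mul_deriv (h : IsTilt L L' a) {n : ℕ} (hn : n ≤ 4) :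
    Integrable fun y => y ^ n * L' y * tiltedDensity L y := by
  have := h.continuous_deriv
  have ha : 0 ≤ a := (abs_nonneg _).trans (h.abs_deriv_le 0)
  refine h.integrable_mul (C := a) (by fun_prop) fun y => ?_
  rw [abs_mul, abs_pow, mul_comm]
  exact mul_le_mul (h.abs_deriv_le y) (abs_pow_le_one_add_pow_four y hn) (by positivity) ha

lemma hasDerivAt_pow_mul_density (h : IsTilt L L' a) (n : ℕ) (y : ℝ) :
    HasDerivAt (fun y => y ^ n * tiltedDensity L y)
      (n * (y ^ (n - 1) * tiltedDensity L y) + y ^ n * L' y * tiltedDensity L y -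
        y ^ (n + 1) * tiltedDensity L y) y := by
  have hexponent : HasDerivAt (fun y : ℝ => -(y ^ 2 / 2) + L y) (-y + L' y) y :=
    ((((hasDerivAt_pow 2 y).div_const 2).neg).add (h.hasDerivAt y)).congr_deriv (by norm_num)
  refine ((hasDerivAt_pow n y).mul hexponent.exp).congr_deriv ?_
  simp only [tiltedDensity]
  ring

lemma integral_pow_succ (h : IsTilt L L' a) {n : ℕ} (hn : n ≤ 3) :
    ∫ y, y ^ (n + 1) * tiltedDensity L y =
      n * (∫ y, y ^ (n - 1) * tiltedDensity L y) + ∫ y, y ^ n * L' y * tiltedDensity L y := by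
  have hpow := h.integrable_pow (n := n) (by lia)
  have hpred := (h.integrable_pow (n := n - 1) (by lia)).const_mul (n : ℝ)
  have hderiv := h.integrable_pow_mul_deriv (n := n) (by lia)
  have hsucc := h.integrable_pow (n := n + 1) (by lia)
  have := integral_eq_zero_of_hasDerivAt_of_integrable (h.hasDerivAt_pow_mul_density n)
    ((hpred.add hderiv).sub hsucc) hpow
  rw [integral_sub (by exact hpred.add hderiv) hsucc, integral_add hpred hderiv,
    integral_const_mul] at this
  linarith

end IsTilt

lemma integral_tiltedDensity_linear (a : ℝ) :
    ∫ y, tiltedDensity (fun y => a * y) y = Real.sqrt (2 * Real.pi) * Real.exp (a ^ 2 / 2) :=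
  integral_exp_neg_half_sq_add_mul a

lemma integral_moments_linear (a : ℝ) :
    ∫ y, y ^ 2 * tiltedDensity (fun y => a * y) y =
        (1 + a ^ 2) * ∫ y, tiltedDensity (fun y => a * y) y ∧
      ∫ y, y ^ 4 * tiltedDensity (fun y => a * y) y =
        (3 + 6 * a ^ 2 + a ^ 4) * ∫ y, tiltedDensity (fun y => a * y) y := by
  have hL := isTilt_linear a
  have hmul (n : ℕ) : ∫ y, y ^ n * a * tiltedDensity (fun y => a * y) y =
      a * ∫ y, y ^ n * tiltedDensity (fun y => a * y) y := by
    simp only [mul_comm _ a, mul_assoc, integral_const_mul]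
  have h0 := hL.integral_pow_succ (n := 0) (by norm_num)
  have h1 := hL.integral_pow_succ (n := 1) (by norm_num)
  have h2 := hL.integral_pow_succ (n := 2) (by norm_num)
  have h3 := hL.integral_pow_succ (n := 3) (by norm_num)
  rw [hmul] at h0 h1 h2 h3
  norm_num at h0 h1 h2 h3
  constructor
  · rw [h1, h0]
    ring
  · rw [h3, h2, h1, h0]
    ring

/-! ### The auxiliary Gaussian variable -/

/-- `log (cosh x)`, the logarithm of the normalization of one spin in the field `x`. -/
def logCosh (x : ℝ) : ℝ := Real.log (Real.cosh x)

lemma hasDerivAt_logCosh (x : ℝ) : HasDerivAt logCosh (Real.tanh x) x := by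
  rw [Real.tanh_eq_sinh_div_cosh]
  exact (Real.hasDerivAt_cosh x).log (Real.cosh_pos x).ne'

lemma continuous_tanh : Continuous Real.tanh := by
  rw [funext Real.tanh_eq_sinh_div_cosh]
  exact Real.continuous_sinh.div Real.continuous_cosh fun x => (Real.cosh_pos x).ne'

section HubbardStratonovich

variable {n : ℕ}

/-- Given the field `h`, the auxiliary Gaussian variable has a density proportional to that of the
standard Gaussian measure times `exp (fieldTilt θ S h y)`, the product over the clique of
`cosh (h_i + √(θ / k) y) / cosh h_i`. -/
def fieldTilt (θ : ℝ) (S : Finset (Fin n)) (h : Fin n → ℝ) (y : ℝ) : ℝ :=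
  ∑ i ∈ S, (logCosh (h i + Real.sqrt (θ / S.card) * y) - logCosh (h i))

/-- The derivative of `fieldTilt`. -/
def fieldTiltDeriv (θ : ℝ) (S : Finset (Fin n)) (h : Fin n → ℝ) (y : ℝ) : ℝ :=
  Real.sqrt (θ / S.card) * ∑ i ∈ S, Real.tanh (h i + Real.sqrt (θ / S.card) * y)

lemma isTilt_fieldTilt (θ : ℝ) (S : Finset (Fin n)) (h : Fin n → ℝ) :
    IsTilt (fieldTilt θ S h) (fieldTiltDeriv θ S h) (Real.sqrt (θ / S.card) * S.card) where
  hasDerivAt y := by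
    unfold fieldTiltDeriv
    rw [Finset.mul_sum]
    refine HasDerivAt.fun_sum fun i _ => ?_
    have hinner : HasDerivAt (fun y => h i + Real.sqrt (θ / S.card) * y)
        (Real.sqrt (θ / S.card)) y := by
      simpa using ((hasDerivAt_id y).const_mul (Real.sqrt (θ / S.card))).const_add (h i)
    rw [mul_comm]
    exact ((hasDerivAt_logCosh _).comp y hinner).sub_const _
  continuous_deriv := by
    have := continuous_tanh
    unfold fieldTiltDeriv
    fun_prop
  abs_deriv_le y := by
    unfold fieldTiltDeriv
    rw [abs_mul, abs_of_nonneg (Real.sqrt_nonneg _)]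
    gcongr
    calc _ ≤ ∑ i ∈ S, |Real.tanh (h i + Real.sqrt (θ / S.card) * y)| :=
          Finset.abs_sum_le_sum_abs _ _
      _ ≤ ∑ _i ∈ S, (1 : ℝ) := Finset.sum_le_sum fun i _ => (Real.abs_tanh_lt_one _).le
      _ = S.card := by simp
  map_zero := by simp [fieldTilt]

lemma sum_config_prod (f : Fin n → Bool → ℝ) :
    ∑ σ : Config n, ∏ i, f i (σ i) = ∏ i, (f i true + f i false) := by
  simp only [← Fintype.sum_bool, Finset.prod_univ_sum, Fintype.piFinset_univ]

lemma sum_exp_mul_spin (g : Fin n → ℝ) :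
    ∑ σ : Config n, Real.exp (∑ i, g i * spin (σ i)) = ∏ i, (2 * Real.cosh (g i)) := by
  simp only [Real.exp_sum]
  rw [sum_config_prod fun i b => Real.exp (g i * spin b)]
  refine Finset.prod_congr rfl fun i _ => ?_
  simp only [spin, if_true, Bool.false_eq_true, if_false, mul_one, mul_neg, Real.cosh_eq]
  ring

lemma prod_two_mul_cosh_pos (h : Fin n → ℝ) : 0 < ∏ i, (2 * Real.cosh (h i)) :=
  Finset.prod_pos fun _ _ => mul_pos two_pos (Real.cosh_pos _)

lemma exp_fieldTilt (θ : ℝ) (S : Finset (Fin n)) (h : Fin n → ℝ) (y : ℝ) :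
    Real.exp (fieldTilt θ S h y) =
      ∏ i ∈ S, Real.cosh (h i + Real.sqrt (θ / S.card) * y) / Real.cosh (h i) := by
  rw [fieldTilt, Real.exp_sum]
  refine Finset.prod_congr rfl fun i _ => ?_
  rw [Real.exp_sub, logCosh, logCosh, Real.exp_log (Real.cosh_pos _),
    Real.exp_log (Real.cosh_pos _)]

lemma sum_exp_spinSum (θ : ℝ) (S : Finset (Fin n)) (h : Fin n → ℝ) (y : ℝ) :
    ∑ σ : Config n, Real.exp (Real.sqrt (θ / S.card) * spinSum S σ * y) *
        Real.exp (∑ i, h i * spin (σ i)) =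
      (∏ i, (2 * Real.cosh (h i))) * Real.exp (fieldTilt θ S h y) := by
  set s := Real.sqrt (θ / S.card)
  have hshift (σ : Config n) :
      Real.exp (s * spinSum S σ * y) * Real.exp (∑ i, h i * spin (σ i)) =
        Real.exp (∑ i, (h i + if i ∈ S then s * y else 0) * spin (σ i)) := by
    rw [← Real.exp_add]
    congr 1
    simp only [add_mul, Finset.sum_add_distrib, ite_mul, zero_mul]
    rw [Finset.sum_ite_mem, Finset.univ_inter, ← Finset.mul_sum, spinSum]
    ring
  have hprod : Real.exp (fieldTilt θ S h y) =
      ∏ i, if i ∈ S then Real.cosh (h i + s * y) / Real.cosh (h i) else 1 := by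
    rw [Finset.prod_ite_mem, Finset.univ_inter, exp_fieldTilt]
  simp only [hshift]
  rw [sum_exp_mul_spin, hprod, ← Finset.prod_mul_distrib]
  refine Finset.prod_congr rfl fun i _ => ?_
  have := (Real.cosh_pos (h i)).ne'
  split_ifs
  · field_simp
  · rw [add_zero, mul_one]

section Averages

variable {θ : ℝ} {g G : ℝ → ℝ}

/-- The Hubbard–Stratonovich transform: given the spins, the auxiliary variable is Gaussian with
mean `√(θ / k) ∑_{i ∈ S} σ_i` and variance `1`, and given that variable the spins are
independent. -/
lemma integral_mul_tiltedDensity_fieldTilt (hθ : 0 ≤ θ) (S : Finset (Fin n)) (h : Fin n → ℝ)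
    (hgi : ∀ a, Integrable fun y => g y * tiltedDensity (fun y => a * y) y)
    (hg : ∀ a, ∫ y, g y * tiltedDensity (fun y => a * y) y =
      G a * ∫ y, tiltedDensity (fun y => a * y) y) :
    (∏ i, (2 * Real.cosh (h i))) * ∫ y, g y * tiltedDensity (fieldTilt θ S h) y =
      Real.sqrt (2 * Real.pi) *
        ∑ σ, weight θ S h σ * G (Real.sqrt (θ / S.card) * spinSum S σ) := by
  have hexpand (y : ℝ) :
      (∏ i, (2 * Real.cosh (h i))) * (g y * tiltedDensity (fieldTilt θ S h) y) =
        ∑ σ : Config n, Real.exp (∑ i, h i * spin (σ i)) *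
          (g y * tiltedDensity (fun y => Real.sqrt (θ / S.card) * spinSum S σ * y) y) := by
    rw [tiltedDensity, Real.exp_add]
    calc _ = g y * Real.exp (-(y ^ 2 / 2)) *
          ((∏ i, (2 * Real.cosh (h i))) * Real.exp (fieldTilt θ S h y)) := by ring
      _ = _ := by
        rw [← sum_exp_spinSum, Finset.mul_sum]
        refine Finset.sum_congr rfl fun σ _ => ?_
        rw [tiltedDensity, Real.exp_add]
        ring
  rw [← integral_const_mul]
  simp only [hexpand]
  rw [integral_finsetSum _ fun σ _ => (hgi _).const_mul _, Finset.mul_sum]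
  refine Finset.sum_congr rfl fun σ _ => ?_
  rw [integral_const_mul, hg, integral_tiltedDensity_linear, weight, Real.exp_add, mul_pow,
    Real.sq_sqrt (by positivity),
    show θ / S.card * spinSum S σ ^ 2 / 2 = θ / (2 * S.card) * spinSum S σ ^ 2 by ring]
  ring

lemma integral_tiltedDensity_fieldTilt (hθ : 0 ≤ θ) (S : Finset (Fin n)) (h : Fin n → ℝ) :
    (∏ i, (2 * Real.cosh (h i))) * ∫ y, tiltedDensity (fieldTilt θ S h) y =
      Real.sqrt (2 * Real.pi) * ∑ σ, weight θ S h σ := by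
  simpa using integral_mul_tiltedDensity_fieldTilt (g := fun _ => 1) (G := fun _ => 1) hθ S h
    (fun a => by simpa using (isTilt_linear a).integrable_density) (fun a => by simp)

lemma one_le_integral_tiltedDensity (hθ : 0 ≤ θ) (S : Finset (Fin n)) (h : Fin n → ℝ) :
    1 ≤ ∫ y, tiltedDensity (fieldTilt θ S h) y := by
  have hp := prod_two_mul_cosh_pos h
  have hfree : ∏ i, (2 * Real.cosh (h i)) ≤ ∑ σ, weight θ S h σ := by
    rw [← sum_exp_mul_spin]
    refine Finset.sum_le_sum fun σ _ => Real.exp_le_exp.2 (le_add_of_nonneg_left ?_)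
    positivity
  have hsqrt : 1 ≤ Real.sqrt (2 * Real.pi) := by
    rw [Real.one_le_sqrt]
    linarith [Real.pi_gt_three]
  refine le_of_mul_le_mul_left ?_ hp
  rw [integral_tiltedDensity_fieldTilt hθ, mul_one]
  exact hfree.trans (le_mul_of_one_le_left (hp.le.trans hfree) hsqrt)

lemma integral_mul_tiltedDensity_eq_gibbsAvg (hθ : 0 ≤ θ) (S : Finset (Fin n)) (h : Fin n → ℝ)
    (hgi : ∀ a, Integrable fun y => g y * tiltedDensity (fun y => a * y) y)
    (hg : ∀ a, ∫ y, g y * tiltedDensity (fun y => a * y) y =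
      G a * ∫ y, tiltedDensity (fun y => a * y) y) :
    ∫ y, g y * tiltedDensity (fieldTilt θ S h) y =
      gibbsAvg θ S h (fun σ => G (Real.sqrt (θ / S.card) * spinSum S σ)) *
        ∫ y, tiltedDensity (fieldTilt θ S h) y := by
  have hZ := sum_weight_pos θ S h
  rw [gibbsAvg_eq_div]
  apply mul_left_cancel₀ (prod_two_mul_cosh_pos h).ne'
  rw [integral_mul_tiltedDensity_fieldTilt hθ S h hgi hg, mul_left_comm,
    integral_tiltedDensity_fieldTilt hθ S]
  field_simp

end Averages

/-- The fourth moment of the auxiliary Gaussian variable given the field `h`, written as the Gibbs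
average of its fourth moment given the spins. -/
def fourthMoment (θ : ℝ) (S : Finset (Fin n)) (h : Fin n → ℝ) : ℝ :=
  gibbsAvg θ S h fun σ => 3 + 6 * (θ * pairStat S σ) + (θ * pairStat S σ) ^ 2

lemma sq_sqrt_mul_spinSum {θ : ℝ} (hθ : 0 ≤ θ) (S : Finset (Fin n)) (σ : Config n) :
    (Real.sqrt (θ / S.card) * spinSum S σ) ^ 2 = θ * pairStat S σ := by
  rw [mul_pow, Real.sq_sqrt (by positivity), pairStat_eq]
  ring

lemma integral_sq_mul_tiltedDensity_fieldTilt {θ : ℝ} (hθ : 0 ≤ θ) (S : Finset (Fin n))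
    (h : Fin n → ℝ) :
    ∫ y, y ^ 2 * tiltedDensity (fieldTilt θ S h) y =
      gibbsAvg θ S h (fun σ => 1 + θ * pairStat S σ) *
        ∫ y, tiltedDensity (fieldTilt θ S h) y := by
  simp only [← sq_sqrt_mul_spinSum hθ]
  exact integral_mul_tiltedDensity_eq_gibbsAvg (G := fun a => 1 + a ^ 2) hθ S h
    (fun a => (isTilt_linear a).integrable_pow (by norm_num))
    (fun a => (integral_moments_linear a).1)

lemma integral_pow_four_mul_tiltedDensity_fieldTilt {θ : ℝ} (hθ : 0 ≤ θ) (S : Finset (Fin n))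
    (h : Fin n → ℝ) :
    ∫ y, y ^ 4 * tiltedDensity (fieldTilt θ S h) y =
      fourthMoment θ S h * ∫ y, tiltedDensity (fieldTilt θ S h) y := by
  simp only [fourthMoment, ← sq_sqrt_mul_spinSum hθ, ← pow_mul]
  exact integral_mul_tiltedDensity_eq_gibbsAvg (G := fun a => 3 + 6 * a ^ 2 + a ^ 4) hθ S h
    (fun a => (isTilt_linear a).integrable_pow le_rfl)
    (fun a => (integral_moments_linear a).2)

end HubbardStratonovich

/-! ### Second moment of the auxiliary variable -/

/-- `1 / cosh² x`, the derivative of `tanh`. -/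
def sechSq (x : ℝ) : ℝ := 1 / Real.cosh x ^ 2

lemma sechSq_eq (x : ℝ) : sechSq x = 1 - Real.tanh x ^ 2 := by
  have := (Real.cosh_pos x).ne'
  rw [sechSq, Real.tanh_eq_sinh_div_cosh, div_pow, Real.sinh_sq]
  field_simp
  ring

lemma sechSq_pos (x : ℝ) : 0 < sechSq x := by
  have := Real.cosh_pos x
  unfold sechSq
  positivity

lemma sechSq_le_one (x : ℝ) : sechSq x ≤ 1 := by
  rw [sechSq_eq]
  linarith [sq_nonneg (Real.tanh x)]

lemma continuous_sechSq : Continuous sechSq := by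
  rw [funext sechSq_eq]
  exact continuous_const.sub (continuous_tanh.pow 2)

lemma hasDerivAt_tanh (x : ℝ) : HasDerivAt Real.tanh (sechSq x) x := by
  have h := (Real.hasDerivAt_sinh x).div (Real.hasDerivAt_cosh x) (Real.cosh_pos x).ne'
  rw [funext Real.tanh_eq_sinh_div_cosh]
  refine h.congr_deriv ?_
  rw [sechSq, ← pow_two, ← pow_two, Real.cosh_sq']
  ring

lemma abs_tanh_sub_tanh_le (x z : ℝ) : |Real.tanh x - Real.tanh z| ≤ |x - z| := by
  have := convex_univ.norm_image_sub_le_of_norm_hasDerivWithin_le (C := 1)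
    (fun x _ => (hasDerivAt_tanh x).hasDerivWithinAt)
    (fun x _ => by rw [Real.norm_of_nonneg (sechSq_pos x).le]; exact sechSq_le_one x)
    (Set.mem_univ z) (Set.mem_univ x)
  simpa using this

lemma abs_sechSq_sub_sechSq_le (x z : ℝ) : |sechSq x - sechSq z| ≤ 2 * |x - z| := by
  rw [sechSq_eq, sechSq_eq,
    show 1 - Real.tanh x ^ 2 - (1 - Real.tanh z ^ 2) =
      -((Real.tanh x + Real.tanh z) * (Real.tanh x - Real.tanh z)) by ring, abs_neg, abs_mul]
  refine mul_le_mul ?_ (abs_tanh_sub_tanh_le x z) (abs_nonneg _) (by norm_num)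
  linarith [abs_add_le (Real.tanh x) (Real.tanh z), Real.abs_tanh_lt_one x, Real.abs_tanh_lt_one z]

lemma abs_tanh_add_sub_sub_le (x a : ℝ) :
    |Real.tanh (x + a) - Real.tanh x - a * sechSq x| ≤ 2 * a ^ 2 := by
  have hderiv (b : ℝ) : HasDerivAt (fun b => Real.tanh (x + b) - b * sechSq x)
      (sechSq (x + b) - sechSq x) b := by
    have hadd : HasDerivAt (fun b => x + b) 1 b := (hasDerivAt_id b).const_add x
    refine (((hasDerivAt_tanh (x + b)).comp b hadd).sub
      ((hasDerivAt_id b).mul_const (sechSq x))).congr_deriv ?_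
    ring
  have := (convex_Icc (-|a|) |a|).norm_image_sub_le_of_norm_hasDerivWithin_le (C := 2 * |a|)
    (fun b _ => (hderiv b).hasDerivWithinAt)
    (fun b hb => by
      have h := abs_sechSq_sub_sechSq_le (x + b) x
      rw [add_sub_cancel_left] at h
      exact h.trans (mul_le_mul_of_nonneg_left (abs_le.2 hb) (by norm_num)))
    (x := 0) (y := a) ⟨by simp, abs_nonneg a⟩ ⟨neg_abs_le a, le_abs_self a⟩
  simp only [add_zero, zero_mul, sub_zero, Real.norm_eq_abs] at this
  rwa [mul_assoc, abs_mul_abs_self, ← pow_two, sub_right_comm] at this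

namespace IsTilt

variable {L L' : ℝ → ℝ} {a : ℝ}

lemma integral_mul_deriv_sub_linear (h : IsTilt L L' a) (m c : ℝ) :
    ∫ y, (m + c * y) * (L' y - m - (1 - c) * y) * tiltedDensity L y =
      c ^ 2 * (∫ y, y ^ 2 * tiltedDensity L y) - (c + m ^ 2) * ∫ y, tiltedDensity L y := by
  have hparts0 := h.integral_pow_succ (n := 0) (by norm_num)
  have hparts1 := h.integral_pow_succ (n := 1) (by norm_num)
  norm_num at hparts0 hparts1
  have i0 := h.integrable_density
  have i1 : Integrable fun y => y * tiltedDensity L y := by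
    simpa using h.integrable_pow (n := 1) (by norm_num)
  have i2 := h.integrable_pow (n := 2) (by norm_num)
  have j0 : Integrable fun y => L' y * tiltedDensity L y := by
    simpa using h.integrable_pow_mul_deriv (n := 0) (by norm_num)
  have j1 : Integrable fun y => y * L' y * tiltedDensity L y := by
    simpa using h.integrable_pow_mul_deriv (n := 1) (by norm_num)
  have hexpand (y : ℝ) : (m + c * y) * (L' y - m - (1 - c) * y) * tiltedDensity L y =
      (m * (L' y * tiltedDensity L y) + c * (y * L' y * tiltedDensity L y)) -
        (m ^ 2 * tiltedDensity L y + m * (y * tiltedDensity L y) +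
          c * (1 - c) * (y ^ 2 * tiltedDensity L y)) := by
    ring
  have j01 : Integrable fun y => m * (L' y * tiltedDensity L y) +
      c * (y * L' y * tiltedDensity L y) := (j0.const_mul _).add (j1.const_mul _)
  have i01 : Integrable fun y => m ^ 2 * tiltedDensity L y + m * (y * tiltedDensity L y) :=
    (i0.const_mul _).add (i1.const_mul _)
  simp only [hexpand]
  rw [integral_sub j01 (by exact i01.add (i2.const_mul _)),
    integral_add (j0.const_mul _) (j1.const_mul _), integral_add i01 (i2.const_mul _),
    integral_add (i0.const_mul _) (i1.const_mul _)]
  simp only [integral_const_mul]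
  rw [← hparts0, show ∫ y, y * L' y * tiltedDensity L y =
    (∫ y, y ^ 2 * tiltedDensity L y) - ∫ y, tiltedDensity L y by linarith]
  ring

/-- If `L' y` were exactly `m + (1 - c) y`, the tilted density would be that of a Gaussian variable
with mean `m / c` and variance `1 / c`. -/
lemma abs_integral_sq_sub_le (h : IsTilt L L' a) {m c A B : ℝ}
    (hrem : ∀ y, |(m + c * y) * (L' y - m - (1 - c) * y)| ≤ A + B * y ^ 4) :
    |c ^ 2 * (∫ y, y ^ 2 * tiltedDensity L y) - (c + m ^ 2) * ∫ y, tiltedDensity L y| ≤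
      A * (∫ y, tiltedDensity L y) + B * ∫ y, y ^ 4 * tiltedDensity L y := by
  have i0 := h.integrable_density.const_mul A
  have i4 := (h.integrable_pow le_rfl).const_mul B
  rw [← h.integral_mul_deriv_sub_linear, ← integral_const_mul, ← integral_const_mul,
    ← integral_add i0 i4, ← Real.norm_eq_abs]
  refine norm_integral_le_of_norm_le (i0.add i4) (ae_of_all _ fun y => ?_)
  rw [norm_mul, Real.norm_of_nonneg (tiltedDensity_pos L y).le]
  exact (mul_le_mul_of_nonneg_right (hrem y) (tiltedDensity_pos L y).le).trans_eq (by ring)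

end IsTilt

section CliqueAverages

variable {n : ℕ} {θ : ℝ} {S : Finset (Fin n)}

/-- `k^{-1/2} ∑_{i ∈ S} tanh h_i`, which is asymptotically Gaussian with variance
`E[tanh² h] = 1 - q`. -/
def tanhSum (S : Finset (Fin n)) (h : Fin n → ℝ) : ℝ :=
  (∑ i ∈ S, Real.tanh (h i)) / Real.sqrt S.card

/-- The mean of `sech² h_i` over the clique, which concentrates around `q = E[sech² h]`. -/
def sechSqMean (S : Finset (Fin n)) (h : Fin n → ℝ) : ℝ :=
  (∑ i ∈ S, sechSq (h i)) / S.card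

lemma fieldTiltDeriv_sub_eq (hθ : 0 ≤ θ) (S : Finset (Fin n)) (h : Fin n → ℝ) (y : ℝ) :
    fieldTiltDeriv θ S h y - Real.sqrt θ * tanhSum S h - θ * sechSqMean S h * y =
      Real.sqrt (θ / S.card) * ∑ i ∈ S, (Real.tanh (h i + Real.sqrt (θ / S.card) * y) -
        Real.tanh (h i) - Real.sqrt (θ / S.card) * y * sechSq (h i)) := by
  have htanh : Real.sqrt θ * tanhSum S h =
      Real.sqrt (θ / S.card) * ∑ i ∈ S, Real.tanh (h i) := by
    rw [Real.sqrt_div hθ, tanhSum]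
    ring
  have hsech : θ * sechSqMean S h * y =
      Real.sqrt (θ / S.card) ^ 2 * (∑ i ∈ S, sechSq (h i)) * y := by
    rw [Real.sq_sqrt (by positivity), sechSqMean]
    ring
  rw [htanh, hsech, fieldTiltDeriv, Finset.sum_sub_distrib, Finset.sum_sub_distrib,
    ← Finset.mul_sum]
  ring

lemma abs_fieldTiltDeriv_sub_le (hθ : 0 ≤ θ) (hS : S.Nonempty) (h : Fin n → ℝ) (y : ℝ) :
    |fieldTiltDeriv θ S h y - Real.sqrt θ * tanhSum S h - θ * sechSqMean S h * y| ≤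
      2 * Real.sqrt θ ^ 3 * y ^ 2 / Real.sqrt S.card := by
  have hk : (0 : ℝ) < S.card := by exact_mod_cast hS.card_pos
  rw [fieldTiltDeriv_sub_eq hθ, abs_mul, abs_of_nonneg (Real.sqrt_nonneg _)]
  set s := Real.sqrt (θ / S.card) with hs
  calc _ ≤ s * ∑ i ∈ S, 2 * (s * y) ^ 2 := by
        gcongr
        exact (Finset.abs_sum_le_sum_abs _ _).trans
          (Finset.sum_le_sum fun i _ => abs_tanh_add_sub_sub_le _ _)
    _ = 2 * s ^ 3 * S.card * y ^ 2 := by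
        rw [Finset.sum_const, nsmul_eq_mul]
        ring
    _ = _ := by
        rw [hs, Real.sqrt_div hθ]
        nth_rewrite 2 [← Real.sq_sqrt hk.le]
        field_simp

lemma mul_le_sq_div_add_mul_sq {r : ℝ} (hr : 0 < r) (p D : ℝ) :
    p * D ≤ p ^ 2 / r + r * D ^ 2 := by
  have : 0 ≤ (p - r * D / 2) ^ 2 / r := by positivity
  have hsq : (p - r * D / 2) ^ 2 / r = p ^ 2 / r - p * D + r * D ^ 2 / 4 := by
    field_simp
    ring
  nlinarith [mul_nonneg hr.le (sq_nonneg D)]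

lemma mul_remainder_le {t a b r D R : ℝ} (ht : 0 ≤ t) (ha : 0 ≤ a) (hb : 0 ≤ b) (hr : 0 < r)
    (hR : R ≤ 2 * t ^ 3 * b ^ 2 / r + t ^ 2 * b * D) :
    (t * a + b) * R ≤ (2 * t ^ 4 + 3 * t ^ 3 + t ^ 2) * ((1 + a ^ 4 + b ^ 4) / r + r * D ^ 2) := by
  set X := (1 + a ^ 4 + b ^ 4) / r + r * D ^ 2 with hX
  have hD : 0 ≤ r * D ^ 2 := by positivity
  have hdiv {p : ℝ} (hp : p ≤ 1 + a ^ 4 + b ^ 4) : p / r ≤ X :=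
    (div_le_div_of_nonneg_right hp hr.le).trans (le_add_of_nonneg_right hD)
  have hyoung {p : ℝ} (hp : p ^ 2 ≤ 1 + a ^ 4 + b ^ 4) : p * D ≤ X :=
    (mul_le_sq_div_add_mul_sq hr p D).trans (by rw [hX]; gcongr)
  have h_ab2 : a * b ^ 2 / r ≤ X := hdiv (by
    nlinarith [sq_nonneg (a - b ^ 2), sq_nonneg (a ^ 2 - 1), sq_nonneg (b ^ 2), sq_nonneg a])
  have h_b3 : b ^ 3 / r ≤ X := hdiv (by
    nlinarith [sq_nonneg (b ^ 2 - b), sq_nonneg (b ^ 2 - 1), sq_nonneg (a ^ 2), sq_nonneg (b - 1)])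
  have h_abD : a * b * D ≤ X := hyoung (by
    nlinarith [sq_nonneg (a ^ 2 - b ^ 2), sq_nonneg (a ^ 2), sq_nonneg (b ^ 2)])
  have h_b2D : b ^ 2 * D ≤ X := hyoung (by nlinarith [sq_nonneg (a ^ 2)])
  calc (t * a + b) * R ≤ (t * a + b) * (2 * t ^ 3 * b ^ 2 / r + t ^ 2 * b * D) := by gcongr
    _ = 2 * t ^ 4 * (a * b ^ 2 / r) + 2 * t ^ 3 * (b ^ 3 / r) + t ^ 3 * (a * b * D) +
        t ^ 2 * (b ^ 2 * D) := by ring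
    _ ≤ 2 * t ^ 4 * X + 2 * t ^ 3 * X + t ^ 3 * X + t ^ 2 * X := by gcongr
    _ = _ := by ring

lemma abs_mul_fieldTiltDeriv_sub_le {q : ℝ} (hθ : 0 ≤ θ) (hq : 0 ≤ q) (hθq : θ * q ≤ 1)
    (hS : S.Nonempty) (h : Fin n → ℝ) (y : ℝ) :
    |(Real.sqrt θ * tanhSum S h + (1 - θ * q) * y) *
        (fieldTiltDeriv θ S h y - Real.sqrt θ * tanhSum S h - (1 - (1 - θ * q)) * y)| ≤
      (2 * Real.sqrt θ ^ 4 + 3 * Real.sqrt θ ^ 3 + Real.sqrt θ ^ 2) *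
        ((1 + tanhSum S h ^ 4 + y ^ 4) / Real.sqrt S.card +
          Real.sqrt S.card * (sechSqMean S h - q) ^ 2) := by
  have hr : 0 < Real.sqrt S.card := Real.sqrt_pos.2 (by exact_mod_cast hS.card_pos)
  set t := Real.sqrt θ with ht
  have ht0 : 0 ≤ t := Real.sqrt_nonneg _
  set ξ := tanhSum S h
  set R := fieldTiltDeriv θ S h y - t * ξ - (1 - (1 - θ * q)) * y with hR
  have hRle :
      |R| ≤ 2 * t ^ 3 * |y| ^ 2 / Real.sqrt S.card + t ^ 2 * |y| * |sechSqMean S h - q| := by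
    have hsplit : R = (fieldTiltDeriv θ S h y - t * ξ - θ * sechSqMean S h * y) +
        θ * y * (sechSqMean S h - q) := by
      rw [hR]
      ring
    rw [hsplit]
    refine (abs_add_le _ _).trans (add_le_add ?_ ?_)
    · rw [sq_abs]
      exact abs_fieldTiltDeriv_sub_le hθ hS h y
    · rw [abs_mul, abs_mul, abs_of_nonneg hθ, ht, Real.sq_sqrt hθ]
  have hfactor : |t * ξ + (1 - θ * q) * y| ≤ t * |ξ| + |y| := by
    refine (abs_add_le _ _).trans ?_
    rw [abs_mul, abs_mul, abs_of_nonneg ht0, abs_of_nonneg (sub_nonneg.2 hθq)]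
    gcongr
    exact mul_le_of_le_one_left (abs_nonneg y) (by linarith [mul_nonneg hθ hq])
  have hrem := mul_remainder_le ht0 (abs_nonneg ξ) (abs_nonneg y) hr hRle
  rw [Even.pow_abs (by decide), Even.pow_abs (by decide), sq_abs] at hrem
  rw [abs_mul]
  exact (mul_le_mul_of_nonneg_right hfactor (abs_nonneg R)).trans hrem

theorem abs_gibbsAvg_pairStat_sub_le {q : ℝ} (hθ : 0 ≤ θ) (hq : 0 ≤ q) (hθq : θ * q ≤ 1)
    (hS : S.Nonempty) (h : Fin n → ℝ) :
    |(1 - θ * q) ^ 2 * gibbsAvg θ S h (fun σ => 1 + θ * pairStat S σ) - (1 - θ * q) -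
        θ * tanhSum S h ^ 2| ≤
      (2 * Real.sqrt θ ^ 4 + 3 * Real.sqrt θ ^ 3 + Real.sqrt θ ^ 2) *
        ((1 + tanhSum S h ^ 4 + fourthMoment θ S h) / Real.sqrt S.card +
          Real.sqrt S.card * (sechSqMean S h - q) ^ 2) := by
  set E := 2 * Real.sqrt θ ^ 4 + 3 * Real.sqrt θ ^ 3 + Real.sqrt θ ^ 2
  set r := Real.sqrt S.card
  have hZ : 0 < ∫ y, tiltedDensity (fieldTilt θ S h) y :=
    one_pos.trans_le (one_le_integral_tiltedDensity hθ S h)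
  have hmoments := (isTilt_fieldTilt θ S h).abs_integral_sq_sub_le
    (m := Real.sqrt θ * tanhSum S h) (c := 1 - θ * q)
    (A := E * ((1 + tanhSum S h ^ 4) / r + r * (sechSqMean S h - q) ^ 2)) (B := E / r) fun y =>
      (abs_mul_fieldTiltDeriv_sub_le hθ hq hθq hS h y).trans_eq (by ring)
  rw [integral_sq_mul_tiltedDensity_fieldTilt hθ, integral_pow_four_mul_tiltedDensity_fieldTilt hθ,
    mul_pow, Real.sq_sqrt hθ, ← mul_assoc, ← sub_mul, abs_mul, abs_of_pos hZ, ← mul_assoc,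
    ← add_mul] at hmoments
  rw [sub_sub]
  exact (le_of_mul_le_mul_right hmoments hZ).trans_eq (by ring)

end CliqueAverages

/-! ### Fourth moment of the auxiliary variable for a good field -/

lemma integrable_pow_four_mul_exp_neg {δ : ℝ} (hδ : 0 < δ) :
    Integrable fun y : ℝ => y ^ 4 * Real.exp (-δ * y ^ 2) := by
  have := integrable_rpow_mul_exp_neg_mul_sq hδ (s := (4 : ℕ)) (by norm_num)
  simpa only [Real.rpow_natCast] using this

lemma pow_three_mul_le {b u ε : ℝ} (hb : 0 ≤ b) (hu : 0 ≤ u) (hε : 0 < ε) :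
    b ^ 3 * u ≤ ε * b ^ 4 + u ^ 4 / ε ^ 3 := by
  rcases le_total u (ε * b) with h | h
  · have hpos : 0 ≤ u ^ 4 / ε ^ 3 := by positivity
    linarith [mul_le_mul_of_nonneg_left h (pow_nonneg hb 3)]
  · have hpow : (ε * b) ^ 3 * u ≤ u ^ 3 * u := by gcongr
    have hle : b ^ 3 * u ≤ u ^ 4 / ε ^ 3 := by
      rw [le_div_iff₀ (by positivity)]
      linarith
    exact hle.trans (le_add_of_nonneg_left (by positivity))

lemma three_mul_sq_le {c : ℝ} (hc : 0 < c) (y : ℝ) : 3 * y ^ 2 ≤ c / 4 * y ^ 4 + 9 / c := by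
  have hsq : 0 ≤ (c * y ^ 2 / 2 - 3) ^ 2 / c := by positivity
  have : (c * y ^ 2 / 2 - 3) ^ 2 / c = c / 4 * y ^ 4 - 3 * y ^ 2 + 9 / c := by
    field_simp
    ring
  linarith

lemma three_mul_sq_add_pow_three_mul_le {c m y d : ℝ} (hc : 0 < c) (hm : 0 ≤ m)
    (hd : y * d ≤ m * |y| + (1 - c) * y ^ 2) :
    3 * y ^ 2 + y ^ 3 * d ≤ (1 - c / 2) * y ^ 4 + (9 / c + m ^ 4 / (c / 4) ^ 3) := by
  have hmul := mul_le_mul_of_nonneg_left hd (sq_nonneg y)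
  have hyoung := pow_three_mul_le (abs_nonneg y) hm (by positivity : 0 < c / 4)
  have habs : y ^ 2 * (m * |y|) = |y| ^ 3 * m := by
    rw [pow_succ |y| 2, sq_abs]
    ring
  rw [Even.pow_abs (by decide : Even 4)] at hyoung
  linarith [three_mul_sq_le hc y]

namespace IsTilt

variable {L L' : ℝ → ℝ} {a : ℝ}

lemma pow_three_mul_deriv_mul_density_le (h : IsTilt L L' a) {δ κ y : ℝ} (ha : a ≤ κ * |y|)
    (hL : L y ≤ (1 / 2 - δ) * y ^ 2) :
    y ^ 3 * L' y * tiltedDensity L y ≤ κ * (y ^ 4 * Real.exp (-δ * y ^ 2)) := by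
  have hρ : tiltedDensity L y ≤ Real.exp (-δ * y ^ 2) := Real.exp_le_exp.2 (by linarith)
  have hderiv : y ^ 3 * L' y ≤ |y| ^ 3 * a :=
    calc y ^ 3 * L' y ≤ |y ^ 3 * L' y| := le_abs_self _
      _ = |y| ^ 3 * |L' y| := by rw [abs_mul, abs_pow]
      _ ≤ |y| ^ 3 * a := by gcongr; exact h.abs_deriv_le y
  have ha0 : 0 ≤ a := (abs_nonneg _).trans (h.abs_deriv_le y)
  calc y ^ 3 * L' y * tiltedDensity L y ≤ |y| ^ 3 * a * tiltedDensity L y :=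
        mul_le_mul_of_nonneg_right hderiv (tiltedDensity_pos L y).le
    _ ≤ |y| ^ 3 * (κ * |y|) * Real.exp (-δ * y ^ 2) :=
        mul_le_mul (by gcongr) hρ (tiltedDensity_pos L y).le
          (mul_nonneg (by positivity) (ha0.trans ha))
    _ = κ * (y ^ 4 * Real.exp (-δ * y ^ 2)) := by
        rw [← Even.pow_abs (by decide : Even 4)]
        ring

lemma moment_integrand_le (h : IsTilt L L' a) {c m κ R δ : ℝ} (hc0 : 0 < c) (hc1 : c ≤ 1)
    (hm : 0 ≤ m) (hκ : 0 ≤ κ) (ha : a ≤ κ * R)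
    (hin : ∀ y, |y| ≤ R → y * L' y ≤ m * |y| + (1 - c) * y ^ 2)
    (hout : ∀ y, R ≤ |y| → L y ≤ (1 / 2 - δ) * y ^ 2) (y : ℝ) :
    3 * (y ^ 2 * tiltedDensity L y) + y ^ 3 * L' y * tiltedDensity L y ≤
      ((1 - c / 2) * (y ^ 4 * tiltedDensity L y) +
          (9 / c + m ^ 4 / (c / 4) ^ 3) * tiltedDensity L y) +
        κ * (y ^ 4 * Real.exp (-δ * y ^ 2)) := by
  have hρ := (tiltedDensity_pos L y).le
  rcases le_total |y| R with hy | hy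
  · have hbound :=
      mul_le_mul_of_nonneg_right (three_mul_sq_add_pow_three_mul_le hc0 hm (hin y hy)) hρ
    have : 0 ≤ κ * (y ^ 4 * Real.exp (-δ * y ^ 2)) := by positivity
    linarith
  · have htail := h.pow_three_mul_deriv_mul_density_le (ha.trans (by gcongr)) (hout y hy)
    have hsq : 3 * y ^ 2 ≤ (1 - c / 2) * y ^ 4 + (9 / c + m ^ 4 / (c / 4) ^ 3) := by
      have : 0 ≤ m ^ 4 / (c / 4) ^ 3 := by positivity
      have : 0 ≤ (1 - 3 * c / 4) * y ^ 4 := mul_nonneg (by linarith) (by positivity)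
      linarith [three_mul_sq_le hc0 y]
    linarith [mul_le_mul_of_nonneg_right hsq hρ]

lemma integral_pow_four_le (h : IsTilt L L' a) {c m κ R δ : ℝ} (hc0 : 0 < c) (hc1 : c ≤ 1)
    (hm : 0 ≤ m) (hκ : 0 ≤ κ) (ha : a ≤ κ * R) (hδ : 0 < δ)
    (hin : ∀ y, |y| ≤ R → y * L' y ≤ m * |y| + (1 - c) * y ^ 2)
    (hout : ∀ y, R ≤ |y| → L y ≤ (1 / 2 - δ) * y ^ 2) :
    c / 2 * ∫ y, y ^ 4 * tiltedDensity L y ≤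
      (9 / c + m ^ 4 / (c / 4) ^ 3) * (∫ y, tiltedDensity L y) +
        κ * ∫ y : ℝ, y ^ 4 * Real.exp (-δ * y ^ 2) := by
  have i0 := h.integrable_density.const_mul (9 / c + m ^ 4 / (c / 4) ^ 3)
  have i2 := (h.integrable_pow (n := 2) (by norm_num)).const_mul 3
  have i4 := (h.integrable_pow le_rfl).const_mul (1 - c / 2)
  have j3 := h.integrable_pow_mul_deriv (n := 3) (by norm_num)
  have iI := (integrable_pow_four_mul_exp_neg hδ).const_mul κ
  have hparts := h.integral_pow_succ (n := 3) le_rfl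
  norm_num at hparts
  have hmono := integral_mono (i2.add j3) ((i4.add i0).add iI)
    (h.moment_integrand_le hc0 hc1 hm hκ ha hin hout)
  rw [integral_add' i2 j3, integral_add' (i4.add i0) iI, integral_add' i4 i0] at hmono
  simp only [integral_const_mul] at hmono
  linarith

end IsTilt

section GoodField

variable {n : ℕ} {S : Finset (Fin n)} {θ : ℝ}

lemma sqrt_div_card_mul_card (hθ : 0 ≤ θ) (S : Finset (Fin n)) :
    Real.sqrt (θ / S.card) * S.card = Real.sqrt θ * Real.sqrt S.card := by
  rw [Real.sqrt_div hθ, div_mul_eq_mul_div, mul_div_assoc, Real.div_sqrt]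

lemma fourthMoment_le_of_good {c r δ : ℝ} (hθ : 0 ≤ θ) (hc0 : 0 < c) (hc1 : c ≤ 1) (hr : 0 < r)
    (hδ : 0 < δ) (h : Fin n → ℝ)
    (hin : ∀ y, |y| ≤ r * Real.sqrt S.card →
      y * fieldTiltDeriv θ S h y ≤ Real.sqrt θ * |tanhSum S h| * |y| + (1 - c) * y ^ 2)
    (hout : ∀ y, r * Real.sqrt S.card ≤ |y| → fieldTilt θ S h y ≤ (1 / 2 - δ) * y ^ 2) :
    fourthMoment θ S h ≤ 2 / c * (9 / c + Real.sqrt θ ^ 4 / (c / 4) ^ 3 +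
      Real.sqrt θ / r * ∫ y : ℝ, y ^ 4 * Real.exp (-δ * y ^ 2)) * (1 + tanhSum S h ^ 4) := by
  set t := Real.sqrt θ
  set I := ∫ y : ℝ, y ^ 4 * Real.exp (-δ * y ^ 2)
  set ξ := tanhSum S h
  have ht : 0 ≤ t := Real.sqrt_nonneg _
  have hI : 0 ≤ I := integral_nonneg fun y => by positivity
  have hZ : 1 ≤ ∫ y, tiltedDensity (fieldTilt θ S h) y := one_le_integral_tiltedDensity hθ S h
  set Z := ∫ y, tiltedDensity (fieldTilt θ S h) y
  have hmoment := (isTilt_fieldTilt θ S h).integral_pow_four_le hc0 hc1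
    (by positivity : 0 ≤ t * |ξ|) (by positivity : 0 ≤ t / r)
    ((sqrt_div_card_mul_card hθ S).trans (by field_simp; rw [mul_comm])).le hδ hin hout
  rw [integral_pow_four_mul_tiltedDensity_fieldTilt hθ, mul_pow, Even.pow_abs (by decide : Even 4)]
    at hmoment
  have hξ : 0 ≤ ξ ^ 4 := by positivity
  have hbound : c / 2 * fourthMoment θ S h * Z ≤
      (9 / c + t ^ 4 / (c / 4) ^ 3 + t / r * I) * (1 + ξ ^ 4) * Z := by
    calc c / 2 * fourthMoment θ S h * Z
        ≤ (9 / c + t ^ 4 * ξ ^ 4 / (c / 4) ^ 3) * Z + t / r * I := by linarith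
      _ ≤ (9 / c + t ^ 4 * ξ ^ 4 / (c / 4) ^ 3) * Z + t / r * I * Z := by
          linarith [le_mul_of_one_le_right (by positivity : 0 ≤ t / r * I) hZ]
      _ ≤ (9 / c + t ^ 4 * ξ ^ 4 / (c / 4) ^ 3) * Z + t / r * I * Z +
            (9 / c * ξ ^ 4 + t ^ 4 / (c / 4) ^ 3 + t / r * I * ξ ^ 4) * Z :=
          le_add_of_nonneg_right (by positivity)
      _ = _ := by ring
  calc fourthMoment θ S h = 2 / c * (c / 2 * fourthMoment θ S h) := by field_simp
    _ ≤ 2 / c * ((9 / c + t ^ 4 / (c / 4) ^ 3 + t / r * I) * (1 + ξ ^ 4)) :=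
        mul_le_mul_of_nonneg_left (le_of_mul_le_mul_right hbound (one_pos.trans_le hZ))
          (by positivity)
    _ = _ := by ring

lemma mul_fieldTiltDeriv_le {p r : ℝ} (hθ : 0 ≤ θ) (hS : S.Nonempty) (h : Fin n → ℝ)
    (hp : sechSqMean S h ≤ p) {y : ℝ} (hy : |y| ≤ r * Real.sqrt S.card) :
    y * fieldTiltDeriv θ S h y ≤
      Real.sqrt θ * |tanhSum S h| * |y| + θ * (p + 2 * Real.sqrt θ * r) * y ^ 2 := by
  have hk : 0 < Real.sqrt S.card := Real.sqrt_pos.2 (by exact_mod_cast hS.card_pos)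
  set t := Real.sqrt θ with ht
  set R := fieldTiltDeriv θ S h y - t * tanhSum S h - θ * sechSqMean S h * y with hR
  have hremainder : y * R ≤ θ * (2 * t * r) * y ^ 2 :=
    calc y * R ≤ |y| * |R| := by
          rw [← abs_mul]
          exact le_abs_self _
      _ ≤ (r * Real.sqrt S.card) * (2 * t ^ 3 * y ^ 2 / Real.sqrt S.card) :=
          mul_le_mul hy (abs_fieldTiltDeriv_sub_le hθ hS h y) (abs_nonneg _)
            ((abs_nonneg y).trans hy)
      _ = θ * (2 * t * r) * y ^ 2 := by
          rw [← Real.sq_sqrt hθ, ← ht]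
          field_simp
  have hmean : t * (tanhSum S h * y) ≤ t * |tanhSum S h| * |y| := by
    rw [mul_assoc, ← abs_mul]
    exact mul_le_mul_of_nonneg_left (le_abs_self _) (Real.sqrt_nonneg _)
  have hsech : θ * sechSqMean S h * y ^ 2 ≤ θ * p * y ^ 2 := by gcongr
  calc y * fieldTiltDeriv θ S h y
      = y * R + t * (tanhSum S h * y) + θ * sechSqMean S h * y ^ 2 := by
        rw [hR]
        ring
    _ ≤ _ := by linarith

end GoodField

/-! ### Concentration of the field -/

section CenteredSum

variable {ι : Type*} {μ : Measure ℝ} {g : ℝ → ℝ} {b : ℝ≥0} {ε θ w : ℝ}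

/-- The sum over `S` of the variables `g (h i)`, centered under the law `μ` of the field. -/
def centeredSum (μ : Measure ℝ) (g : ℝ → ℝ) (S : Finset ι) (h : ι → ℝ) : ℝ :=
  ∑ i ∈ S, (g (h i) - ∫ x, g x ∂μ)

lemma centeredSum_eq (μ : Measure ℝ) (g : ℝ → ℝ) (S : Finset ι) (h : ι → ℝ) :
    centeredSum μ g S h = ∑ i ∈ S, g (h i) - S.card * ∫ x, g x ∂μ := by
  rw [centeredSum, Finset.sum_sub_distrib, Finset.sum_const, nsmul_eq_mul]

lemma measurable_centeredSum (hg : Measurable g) (S : Finset ι) :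
    Measurable (centeredSum μ g S) :=
  Finset.measurable_fun_sum S fun i _ => (hg.comp (measurable_pi_apply i)).sub_const _

variable [IsProbabilityMeasure μ]

lemma integrable_of_abs_le (hg : Measurable g) {b : ℝ} (hb : ∀ x, |g x| ≤ b) : Integrable g μ :=
  Integrable.of_bound hg.aestronglyMeasurable b (ae_of_all _ hb)

lemma hasSubgaussianMGF_sub_integral (hg : Measurable g) (hb : ∀ x, |g x| ≤ b) :
    HasSubgaussianMGF (fun x => g x - ∫ x, g x ∂μ) (b ^ 2) μ := by
  have hoeffding := hasSubgaussianMGF_of_mem_Icc (μ := μ) hg.aemeasurable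
    (ae_of_all _ fun x => abs_le.1 (hb x))
  have hparam : ‖(b : ℝ) - -b‖₊ / 2 = b := by
    rw [sub_neg_eq_add, ← two_mul]
    simp
  rwa [hparam] at hoeffding

variable [Fintype ι]

lemma hasSubgaussianMGF_centeredSum (hg : Measurable g) (hb : ∀ x, |g x| ≤ b) (S : Finset ι) :
    HasSubgaussianMGF (centeredSum μ g S) (S.card * b ^ 2) (Measure.pi fun _ : ι => μ) := by
  have hindep : iIndepFun (fun i (h : ι → ℝ) => g (h i) - ∫ x, g x ∂μ)
      (Measure.pi fun _ : ι => μ) :=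
    iIndepFun_pi fun _ => (hg.sub_const _).aemeasurable
  have hcoord (i : ι) : HasSubgaussianMGF (fun h : ι → ℝ => g (h i) - ∫ x, g x ∂μ) (b ^ 2)
      (Measure.pi fun _ : ι => μ) := by
    refine HasSubgaussianMGF.of_map (X := fun x => g x - ∫ x, g x ∂μ)
      (Y := fun h : ι → ℝ => h i) (measurable_pi_apply i).aemeasurable ?_
    rw [(measurePreserving_eval (fun _ : ι => μ) i).map_eq]
    exact hasSubgaussianMGF_sub_integral hg hb
  have hsum := HasSubgaussianMGF.sum_of_iIndepFun hindep (s := S) fun i _ => hcoord i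
  rwa [Finset.sum_const, nsmul_eq_mul] at hsum

lemma measureReal_centeredSum_ge_le (hg : Measurable g) (hb : ∀ x, |g x| ≤ b) (hε : 0 ≤ ε)
    (S : Finset ι) :
    (Measure.pi fun _ : ι => μ).real {h | S.card * ε ≤ centeredSum μ g S h} ≤
      Real.exp (-(ε ^ 2 / (2 * b ^ 2) * S.card)) := by
  refine ((hasSubgaussianMGF_centeredSum hg hb S).measure_ge_le (by positivity)).trans_eq ?_
  rcases S.eq_empty_or_nonempty with rfl | hS
  · simp
  · have hk : (S.card : ℝ) ≠ 0 := by exact_mod_cast hS.card_pos.ne'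
    congr 1
    push_cast
    rw [mul_pow, sq (S.card : ℝ), mul_assoc, neg_div, mul_left_comm 2 (S.card : ℝ),
      mul_div_mul_left _ _ hk]
    ring

lemma hasSubgaussianMGF_centeredSum_div_sqrt (hg : Measurable g) (hb : ∀ x, |g x| ≤ b)
    {S : Finset ι} (hS : S.Nonempty) :
    HasSubgaussianMGF (fun h => centeredSum μ g S h / Real.sqrt S.card) (b ^ 2)
      (Measure.pi fun _ : ι => μ) := by
  have hscaled := (hasSubgaussianMGF_centeredSum (μ := μ) hg hb S).const_mul (Real.sqrt S.card)⁻¹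
  convert hscaled using 1
  · ext h
    rw [div_eq_inv_mul]
  · have hk : (S.card : ℝ) ≠ 0 := by exact_mod_cast hS.card_pos.ne'
    ext
    change (b : ℝ) ^ 2 = (Real.sqrt S.card)⁻¹ ^ 2 * (S.card * (b : ℝ) ^ 2)
    rw [inv_pow, Real.sq_sqrt (by positivity), inv_mul_cancel_left₀ hk]

lemma integral_centeredSum_sq (hg : MemLp g 2 μ) (S : Finset ι) :
    ∫ h, centeredSum μ g S h ^ 2 ∂(Measure.pi fun _ : ι => μ) = S.card * Var[g; μ] := by
  have hmem (i : ι) : MemLp (fun h : ι → ℝ => g (h i)) 2 (Measure.pi fun _ : ι => μ) :=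
    hg.comp_measurePreserving (measurePreserving_eval _ i)
  have hmean : ∫ h, ∑ i ∈ S, g (h i) ∂(Measure.pi fun _ : ι => μ) = S.card * ∫ x, g x ∂μ := by
    rw [integral_finsetSum _ fun i _ => (hmem i).integrable one_le_two,
      Finset.sum_congr rfl fun i _ => integral_comp_eval (μ := fun _ : ι => μ)
        hg.aestronglyMeasurable, Finset.sum_const, nsmul_eq_mul]
  have hvar (i : ι) : Var[fun h : ι → ℝ => g (h i); Measure.pi fun _ : ι => μ] = Var[g; μ] :=
    (measurePreserving_eval (fun _ : ι => μ) i).variance_fun_comp hg.aemeasurable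
  have hindep : iIndepFun (fun i (h : ι → ℝ) => g (h i)) (Measure.pi fun _ : ι => μ) :=
    iIndepFun_pi fun _ => hg.aemeasurable
  calc ∫ h, centeredSum μ g S h ^ 2 ∂(Measure.pi fun _ : ι => μ)
      = Var[∑ i ∈ S, fun h : ι → ℝ => g (h i); Measure.pi fun _ : ι => μ] := by
        rw [variance_eq_integral (memLp_finsetSum' S fun i _ => hmem i).aemeasurable]
        simp only [Finset.sum_apply, hmean, centeredSum_eq]
    _ = ∑ i ∈ S, Var[fun h : ι → ℝ => g (h i); Measure.pi fun _ : ι => μ] :=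
        IndepFun.variance_sum (fun i _ => hmem i) fun i _ j _ hij => hindep.indepFun hij
    _ = S.card * Var[g; μ] := by
        rw [Finset.sum_congr rfl fun i _ => hvar i, Finset.sum_const, nsmul_eq_mul]

lemma quadratic_mul_exp_neg_le (hθ : 0 ≤ θ) (hw : 0 < w) {x : ℝ} (hx : 0 ≤ x) :
    (3 + 6 * (θ * x) + (θ * x) ^ 2) * Real.exp (-(w * x)) ≤
      3 + 6 * (θ / w) + 2 * (θ / w) ^ 2 := by
  have hx' : θ * x = θ / w * (w * x) := by field_simp
  have hy : 0 ≤ w * x := by positivity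
  have hb : 0 ≤ θ / w := by positivity
  rw [Real.exp_neg, ← div_eq_mul_inv, div_le_iff₀ (Real.exp_pos _), hx']
  set y := w * x
  set b := θ / w
  have hexp := Real.quadratic_le_exp_of_nonneg hy
  have hone : 1 ≤ Real.exp y := Real.one_le_exp hy
  have hlin : b * y ≤ b * Real.exp y := by
    gcongr
    linarith [sq_nonneg y]
  have hquad : b ^ 2 * y ^ 2 ≤ b ^ 2 * (2 * Real.exp y) := by
    gcongr
    linarith
  linarith

end CenteredSum

/-! ### The normalized sums of `tanh` and `sech²` -/

section TanhSum

variable {n : ℕ} {μ : Measure ℝ} {S : Finset (Fin n)}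

lemma abs_sechSq_le_one (x : ℝ) : |sechSq x| ≤ 1 := by
  rw [abs_of_pos (sechSq_pos x)]
  exact sechSq_le_one x

lemma integral_tanh_eq_zero (hsymm : μ.map (fun h => -h) = μ) : ∫ x, Real.tanh x ∂μ = 0 := by
  have hreflect : ∫ x, Real.tanh x ∂μ = ∫ x, Real.tanh (-x) ∂μ := by
    conv_lhs => rw [← hsymm]
    exact integral_map measurable_neg.aemeasurable continuous_tanh.aestronglyMeasurable
  simp only [Real.tanh_neg, integral_neg] at hreflect
  linarith

lemma tanhSum_eq (hsymm : μ.map (fun h => -h) = μ) (S : Finset (Fin n)) (h : Fin n → ℝ) :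
    tanhSum S h = centeredSum μ Real.tanh S h / Real.sqrt S.card := by
  rw [tanhSum, centeredSum_eq, integral_tanh_eq_zero hsymm, mul_zero, sub_zero]

lemma sechSqMean_sub_eq (μ : Measure ℝ) (hS : S.Nonempty) (h : Fin n → ℝ) :
    sechSqMean S h - meanSechSq μ = centeredSum μ sechSq S h / S.card := by
  have hk : (S.card : ℝ) ≠ 0 := by exact_mod_cast hS.card_pos.ne'
  rw [sechSqMean, centeredSum_eq, sub_div, mul_div_cancel_left₀ _ hk]
  rfl

variable [IsProbabilityMeasure μ]

lemma hasSubgaussianMGF_tanhSum (hsymm : μ.map (fun h => -h) = μ) (hS : S.Nonempty) :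
    HasSubgaussianMGF (tanhSum S) 1 (Measure.pi fun _ : Fin n => μ) := by
  rw [funext (tanhSum_eq hsymm S), ← one_pow 2]
  exact hasSubgaussianMGF_centeredSum_div_sqrt (b := 1) continuous_tanh.measurable
    (fun x => by simpa using (Real.abs_tanh_lt_one x).le) hS

lemma integral_tanhSum_pow_four_le (hsymm : μ.map (fun h => -h) = μ) (hS : S.Nonempty) :
    ∫ h, tanhSum S h ^ 4 ∂(Measure.pi fun _ : Fin n => μ) ≤ 64 := by
  simpa using integral_pow_four_le_of_hasSubgaussianMGF (hasSubgaussianMGF_tanhSum hsymm hS)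

lemma variance_tanh (hsymm : μ.map (fun h => -h) = μ) :
    Var[Real.tanh; μ] = 1 - meanSechSq μ := by
  have hsq (x : ℝ) : Real.tanh x ^ 2 = 1 - sechSq x := by rw [sechSq_eq, sub_sub_cancel]
  rw [variance_of_integral_eq_zero continuous_tanh.aemeasurable (integral_tanh_eq_zero hsymm)]
  simp only [hsq]
  rw [integral_sub (integrable_const _)
    (integrable_of_abs_le continuous_sechSq.measurable abs_sechSq_le_one), integral_const,
    probReal_univ, one_smul]
  rfl

lemma integral_tanhSum_sq (hsymm : μ.map (fun h => -h) = μ) (hS : S.Nonempty) :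
    ∫ h, tanhSum S h ^ 2 ∂(Measure.pi fun _ : Fin n => μ) = 1 - meanSechSq μ := by
  have hk : (S.card : ℝ) ≠ 0 := by exact_mod_cast hS.card_pos.ne'
  have hmem : MemLp Real.tanh 2 μ :=
    MemLp.of_bound continuous_tanh.aestronglyMeasurable 1
      (ae_of_all _ fun x => (Real.abs_tanh_lt_one x).le)
  simp only [tanhSum_eq hsymm, div_pow, Real.sq_sqrt (Nat.cast_nonneg S.card)]
  rw [integral_div, integral_centeredSum_sq hmem, variance_tanh hsymm, mul_div_cancel_left₀ _ hk]

end TanhSum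

/-! ### The free energy and its empirical version -/

section FreeEnergy

variable {μ : Measure ℝ} {θ : ℝ}

/-- The integrand of the mean-field free energy: the gain in `log cosh` when the field `h` is
shifted by `√θ x`. -/
def energyGain (θ x h : ℝ) : ℝ := logCosh (Real.sqrt θ * x + h) - logCosh h

lemma freeEnergy_eq (μ : Measure ℝ) (θ x : ℝ) :
    freeEnergy μ θ x = x ^ 2 / 2 - ∫ h, energyGain θ x h ∂μ := rfl

lemma freeEnergy_zero (μ : Measure ℝ) (θ : ℝ) : freeEnergy μ θ 0 = 0 := by
  simp [freeEnergy]

lemma continuous_logCosh : Continuous logCosh :=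
  continuous_iff_continuousAt.2 fun x => (hasDerivAt_logCosh x).continuousAt

lemma abs_logCosh_sub_le (x z : ℝ) : |logCosh x - logCosh z| ≤ |x - z| := by
  simpa using convex_univ.norm_image_sub_le_of_norm_hasDerivWithin_le
    (fun x _ => (hasDerivAt_logCosh x).hasDerivWithinAt)
    (fun x _ => (Real.abs_tanh_lt_one x).le) (Set.mem_univ z) (Set.mem_univ x)

lemma continuous_energyGain (θ x : ℝ) : Continuous (energyGain θ x) :=
  (continuous_logCosh.comp (by fun_prop)).sub continuous_logCosh

lemma abs_energyGain_sub_le (θ x z h : ℝ) :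
    |energyGain θ x h - energyGain θ z h| ≤ Real.sqrt θ * |x - z| := by
  rw [energyGain, energyGain, sub_sub_sub_cancel_right]
  refine (abs_logCosh_sub_le _ _).trans_eq ?_
  rw [add_sub_add_right_eq_sub, ← mul_sub, abs_mul, abs_of_nonneg (Real.sqrt_nonneg _)]

lemma abs_energyGain_le (θ x h : ℝ) : |energyGain θ x h| ≤ Real.sqrt θ * |x| := by
  simpa [energyGain] using abs_energyGain_sub_le θ x 0 h

lemma energyGain_le_sq_div_four {x : ℝ} (hx : 4 * Real.sqrt θ ≤ |x|) (h : ℝ) :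
    energyGain θ x h ≤ x ^ 2 / 4 :=
  calc energyGain θ x h ≤ Real.sqrt θ * |x| := (le_abs_self _).trans (abs_energyGain_le θ x h)
    _ ≤ |x| / 4 * |x| := by
      gcongr
      linarith
    _ = x ^ 2 / 4 := by
      rw [div_mul_eq_mul_div, abs_mul_abs_self, sq]

variable [IsProbabilityMeasure μ]

lemma integrable_energyGain (θ x : ℝ) : Integrable (energyGain θ x) μ :=
  integrable_of_abs_le (continuous_energyGain θ x).measurable (abs_energyGain_le θ x)

lemma abs_integral_energyGain_sub_le (μ : Measure ℝ) [IsProbabilityMeasure μ] (θ x z : ℝ) :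
    |∫ h, energyGain θ x h ∂μ - ∫ h, energyGain θ z h ∂μ| ≤ Real.sqrt θ * |x - z| := by
  rw [← integral_sub (integrable_energyGain θ x) (integrable_energyGain θ z)]
  simpa using norm_integral_le_of_norm_le_const (μ := μ)
    (f := fun h => energyGain θ x h - energyGain θ z h) (ae_of_all _ (abs_energyGain_sub_le θ x z))

lemma continuous_freeEnergy (θ : ℝ) : Continuous (freeEnergy μ θ) := by
  have hgain : Continuous fun x => ∫ h, energyGain θ x h ∂μ :=
    (LipschitzWith.of_dist_le_mul (K := ⟨Real.sqrt θ, Real.sqrt_nonneg θ⟩)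
      (abs_integral_energyGain_sub_le μ θ)).continuous
  rw [funext (freeEnergy_eq μ θ)]
  fun_prop

lemma exists_freeEnergy_gap (hmin : ZeroUniqueMinimizer μ θ) {r : ℝ} (hr : 0 < r) (R : ℝ) :
    ∃ ε : ℝ, 0 < ε ∧ ∀ x, r ≤ |x| → |x| ≤ R → ε ≤ freeEnergy μ θ x := by
  have hcompact : IsCompact ({x : ℝ | r ≤ |x|} ∩ Metric.closedBall 0 R) :=
    (isCompact_closedBall 0 R).inter_left (isClosed_le continuous_const continuous_abs)
  have hpos (x : ℝ) (hx : x ∈ {x : ℝ | r ≤ |x|} ∩ Metric.closedBall 0 R) :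
      0 < freeEnergy μ θ x := by
    rw [← freeEnergy_zero μ θ]
    exact hmin x (abs_pos.1 (hr.trans_le hx.1))
  obtain ⟨ε, hε, hle⟩ :=
    hcompact.exists_forall_le' (continuous_freeEnergy θ).continuousOn hpos
  exact ⟨ε, hε, fun x hrx hxR => hle x ⟨hrx, by simpa using hxR⟩⟩

lemma sum_energyGain_le {ι : Type*} (S : Finset ι) (h : ι → ℝ) (θ x z : ℝ) :
    ∑ i ∈ S, energyGain θ x (h i) ≤ centeredSum μ (energyGain θ z) S h +
      S.card * (∫ h, energyGain θ x h ∂μ + 2 * (Real.sqrt θ * |x - z|)) := by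
  have hsum : ∑ i ∈ S, energyGain θ x (h i) ≤
      ∑ i ∈ S, energyGain θ z (h i) + S.card * (Real.sqrt θ * |x - z|) := by
    rw [← nsmul_eq_mul, ← Finset.sum_const, ← Finset.sum_add_distrib]
    exact Finset.sum_le_sum fun i _ =>
      sub_le_iff_le_add'.1 (abs_le.1 (abs_energyGain_sub_le θ x z (h i))).2
  have hint : (S.card : ℝ) * ∫ h, energyGain θ z h ∂μ ≤
      S.card * (∫ h, energyGain θ x h ∂μ + Real.sqrt θ * |x - z|) := by
    gcongr
    linarith [(abs_le.1 (abs_integral_energyGain_sub_le μ θ x z)).1]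
  rw [centeredSum_eq]
  linarith

/-- Since the gain is Lipschitz in `x` and at most linear, it is enough to control its empirical
mean on a finite net of a bounded interval. -/
lemma exists_net_sum_energyGain_le (hθ : 0 < θ) (hmin : ZeroUniqueMinimizer μ θ) {r : ℝ}
    (hr : 0 < r) :
    ∃ (N : Finset ℝ) (ε δ : ℝ), 0 < ε ∧ 0 < δ ∧
      ∀ {ι : Type} (S : Finset ι) (h : ι → ℝ),
        (∀ z ∈ N, centeredSum μ (energyGain θ z) S h ≤ S.card * ε) →
        ∀ x, r ≤ |x| → ∑ i ∈ S, energyGain θ x (h i) ≤ S.card * ((1 / 2 - δ) * x ^ 2) := by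
  have hθ' : 0 < Real.sqrt θ := Real.sqrt_pos.2 hθ
  set R := 4 * Real.sqrt θ
  have hR : 0 < R := by positivity
  obtain ⟨e, he, hgap⟩ := exists_freeEnergy_gap hmin hr R
  obtain ⟨N, -, hNfin, hN⟩ := (isCompact_closedBall (0 : ℝ) R).finite_cover_balls
    (e := e / 4 / Real.sqrt θ) (by positivity)
  refine ⟨hNfin.toFinset, e / 4, min (1 / 4) (e / 4 / R ^ 2), by positivity, by positivity,
    fun S h hdev x hrx => ?_⟩
  set δ := min (1 / 4) (e / 4 / R ^ 2)
  rcases le_total |x| R with hxR | hRx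
  · obtain ⟨z, hzN, hxz⟩ := Set.mem_iUnion₂.1 (hN (by simpa using hxR : x ∈ Metric.closedBall 0 R))
    have hnear : Real.sqrt θ * |x - z| ≤ e / 4 := ((lt_div_iff₀' hθ').1 hxz).le
    have hδ : δ * x ^ 2 ≤ e / 4 :=
      calc δ * x ^ 2 ≤ e / 4 / R ^ 2 * R ^ 2 :=
            mul_le_mul (min_le_right _ _) (sq_le_sq' (abs_le.1 hxR).1 (abs_le.1 hxR).2)
              (by positivity) (by positivity)
        _ = e / 4 := by field_simp
    calc ∑ i ∈ S, energyGain θ x (h i)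
        ≤ S.card * (e / 4) +
          S.card * (∫ h, energyGain θ x h ∂μ + 2 * (Real.sqrt θ * |x - z|)) :=
          (sum_energyGain_le S h θ x z).trans
            (add_le_add_left (hdev z (hNfin.mem_toFinset.2 hzN)) _)
      _ = S.card * (e / 4 + (∫ h, energyGain θ x h ∂μ + 2 * (Real.sqrt θ * |x - z|))) :=
          (mul_add _ _ _).symm
      _ ≤ S.card * ((1 / 2 - δ) * x ^ 2) := by
          gcongr
          have hx := hgap x hrx hxR
          rw [freeEnergy_eq] at hx
          linarith
  · calc ∑ i ∈ S, energyGain θ x (h i) ≤ ∑ _i ∈ S, (1 / 2 - δ) * x ^ 2 := by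
          refine Finset.sum_le_sum fun i _ => (energyGain_le_sq_div_four hRx (h i)).trans ?_
          rw [div_eq_inv_mul]
          gcongr
          linarith [min_le_left (1 / 4) (e / 4 / R ^ 2)]
      _ = S.card * ((1 / 2 - δ) * x ^ 2) := by
          rw [Finset.sum_const, nsmul_eq_mul]

end FreeEnergy

lemma fieldTilt_eq_sum_energyGain {n : ℕ} {θ : ℝ} (hθ : 0 ≤ θ) (S : Finset (Fin n))
    (h : Fin n → ℝ) (y : ℝ) :
    fieldTilt θ S h y = ∑ i ∈ S, energyGain θ (y / Real.sqrt S.card) (h i) := by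
  unfold fieldTilt energyGain
  refine Finset.sum_congr rfl fun i _ => ?_
  rw [Real.sqrt_div hθ, add_comm (h i), div_mul_eq_mul_div, mul_div_assoc]

lemma fieldTilt_le_of_sum_energyGain_le {n : ℕ} {θ δ r : ℝ} (hθ : 0 ≤ θ)
    {S : Finset (Fin n)} (hS : S.Nonempty) {h : Fin n → ℝ}
    (hgain : ∀ x, r ≤ |x| → ∑ i ∈ S, energyGain θ x (h i) ≤ S.card * ((1 / 2 - δ) * x ^ 2))
    {y : ℝ} (hy : r * Real.sqrt S.card ≤ |y|) : fieldTilt θ S h y ≤ (1 / 2 - δ) * y ^ 2 := by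
  have hk : (0 : ℝ) < S.card := by exact_mod_cast hS.card_pos
  have hx : r ≤ |y / Real.sqrt S.card| := by
    rwa [abs_div, abs_of_nonneg (Real.sqrt_nonneg _), le_div_iff₀ (Real.sqrt_pos.2 hk)]
  rw [fieldTilt_eq_sum_energyGain hθ]
  refine (hgain _ hx).trans_eq ?_
  rw [div_pow, Real.sq_sqrt hk.le]
  field_simp

/-! ### Uniform bound on the fourth moment of the auxiliary variable -/

section FourthMoment

variable {μ : Measure ℝ} {θ : ℝ} {n : ℕ} {S : Finset (Fin n)}

lemma abs_spinSum_le (S : Finset (Fin n)) (σ : Config n) : |spinSum S σ| ≤ S.card :=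
  (Finset.abs_sum_le_sum_abs _ _).trans_eq (by simp [abs_spin])

lemma pairStat_le_card (S : Finset (Fin n)) (σ : Config n) : pairStat S σ ≤ S.card := by
  rw [pairStat_eq, ← sq_abs]
  refine div_le_of_le_mul₀ (by positivity) (by positivity) ?_
  rw [← pow_two]
  exact pow_le_pow_left₀ (abs_nonneg _) (abs_spinSum_le S σ) 2

lemma fourthMoment_le_card (hθ : 0 ≤ θ) (S : Finset (Fin n)) (h : Fin n → ℝ) :
    fourthMoment θ S h ≤ 3 + 6 * (θ * S.card) + (θ * S.card) ^ 2 := by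
  rw [← gibbsAvg_const θ S h (3 + 6 * (θ * S.card) + (θ * S.card) ^ 2)]
  refine gibbsAvg_mono θ S h fun σ => ?_
  have hle := pairStat_le_card S σ
  have hnonneg := pairStat_nonneg S σ
  gcongr

lemma meanSechSq_nonneg (μ : Measure ℝ) : 0 ≤ meanSechSq μ :=
  integral_nonneg fun x => (sechSq_pos x).le

lemma fourthMoment_le_of_sechSqMean_le {p r δ : ℝ} (hθ : 0 < θ) (hp0 : 0 ≤ p) (hp : θ * p < 1)
    (hr : r = (1 - θ * p) / (4 * (θ * Real.sqrt θ))) (hδ : 0 < δ) (hS : S.Nonempty) (h : Fin n → ℝ)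
    (hmean : sechSqMean S h ≤ p)
    (hout : ∀ y, r * Real.sqrt S.card ≤ |y| → fieldTilt θ S h y ≤ (1 / 2 - δ) * y ^ 2) :
    fourthMoment θ S h ≤ 2 / ((1 - θ * p) / 2) * (9 / ((1 - θ * p) / 2) +
      Real.sqrt θ ^ 4 / ((1 - θ * p) / 2 / 4) ^ 3 +
        Real.sqrt θ / r * ∫ y, y ^ 4 * Real.exp (-δ * y ^ 2)) * (1 + tanhSum S h ^ 4) := by
  have hgap : 0 < 1 - θ * p := by linarith
  have hr0 : 0 < r := hr ▸ by positivity
  have hslope : θ * (p + 2 * Real.sqrt θ * r) = 1 - (1 - θ * p) / 2 := by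
    rw [hr]
    field_simp
    ring
  refine fourthMoment_le_of_good hθ.le (half_pos hgap) ?_ hr0 hδ h (fun y hy => ?_) hout
  · linarith [mul_nonneg hθ.le hp0]
  · exact hslope ▸ mul_fieldTiltDeriv_le hθ.le hS h hmean hy

lemma fourthMoment_le_add_sum_indicator {C ε : ℝ} (hθ : 0 ≤ θ) (hC : 0 ≤ C) (G : Finset (ℝ → ℝ))
    (h : Fin n → ℝ) (hgood : (∀ g ∈ G, centeredSum μ g S h ≤ S.card * ε) →
      fourthMoment θ S h ≤ C * (1 + tanhSum S h ^ 4)) :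
    fourthMoment θ S h ≤ C * (1 + tanhSum S h ^ 4) +
      ∑ g ∈ G, {h | S.card * ε ≤ centeredSum μ g S h}.indicator
        (fun _ => 3 + 6 * (θ * S.card) + (θ * S.card) ^ 2) h := by
  have hnonneg (g : ℝ → ℝ) : 0 ≤ {h | S.card * ε ≤ centeredSum μ g S h}.indicator
      (fun _ => 3 + 6 * (θ * S.card) + (θ * S.card) ^ 2) h :=
    Set.indicator_nonneg (fun _ _ => by positivity) h
  by_cases hdev : ∀ g ∈ G, centeredSum μ g S h ≤ S.card * ε
  · exact (hgood hdev).trans (le_add_of_nonneg_right (Finset.sum_nonneg fun g _ => hnonneg g))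
  · push Not at hdev
    obtain ⟨g, hgG, hg⟩ := hdev
    refine (fourthMoment_le_card hθ S h).trans ((le_trans ?_
      (Finset.single_le_sum (fun g _ => hnonneg g) hgG)).trans
        (le_add_of_nonneg_left (by positivity)))
    rw [Set.indicator_of_mem (show h ∈ {h | S.card * ε ≤ centeredSum μ g S h} from hg.le)]

variable [IsProbabilityMeasure μ]

lemma exists_fourthMoment_le_of_centeredSum_le (hθ : 0 < θ) (hθq : θ * meanSechSq μ < 1)
    (hmin : ZeroUniqueMinimizer μ θ) :
    ∃ (G : Finset (ℝ → ℝ)) (ε C : ℝ), (∀ g ∈ G, Measurable g ∧ ∃ b : ℝ≥0, ∀ x, |g x| ≤ b) ∧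
      0 < ε ∧ 0 ≤ C ∧ ∀ (n : ℕ) (S : Finset (Fin n)), S.Nonempty → ∀ h : Fin n → ℝ,
        (∀ g ∈ G, centeredSum μ g S h ≤ S.card * ε) →
          fourthMoment θ S h ≤ C * (1 + tanhSum S h ^ 4) := by
  classical
  obtain ⟨p, hqp, hp⟩ := exists_between ((lt_div_iff₀' hθ).2 hθq)
  have hp0 : 0 < p := (meanSechSq_nonneg μ).trans_lt hqp
  have hθp : θ * p < 1 := (lt_div_iff₀' hθ).1 hp
  have hgap : 0 < 1 - θ * p := by linarith
  set r := (1 - θ * p) / (4 * (θ * Real.sqrt θ)) with hr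
  have hr0 : 0 < r := by positivity
  obtain ⟨N, ε, δ, hε, hδ, hN⟩ := exists_net_sum_energyGain_le hθ hmin hr0
  have htail : 0 ≤ ∫ y : ℝ, y ^ 4 * Real.exp (-δ * y ^ 2) :=
    integral_nonneg fun y => by positivity
  refine ⟨insert sechSq (N.image (energyGain θ)), min ε (p - meanSechSq μ), _, ?_,
    lt_min hε (sub_pos.2 hqp), ?_, fun n S hS h hdev =>
      fourthMoment_le_of_sechSqMean_le hθ hp0.le hθp hr hδ hS h ?_ fun y =>
        fieldTilt_le_of_sum_energyGain_le hθ.le hS (hN S h fun z hz => ?_)⟩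
  · simp only [Finset.forall_mem_insert, Finset.forall_mem_image]
    exact ⟨⟨continuous_sechSq.measurable, 1, by simpa using abs_sechSq_le_one⟩, fun x _ =>
      ⟨(continuous_energyGain θ x).measurable, ⟨Real.sqrt θ * |x|, by positivity⟩,
        abs_energyGain_le θ x⟩⟩
  · positivity
  · have hk : (0 : ℝ) < S.card := by exact_mod_cast hS.card_pos
    have hle : centeredSum μ sechSq S h / S.card ≤ p - meanSechSq μ := by
      rw [div_le_iff₀' hk]
      exact (hdev sechSq (Finset.mem_insert_self _ _)).trans (by gcongr; exact min_le_right _ _)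
    linarith [sechSqMean_sub_eq μ hS h]
  · exact (hdev _ (Finset.mem_insert_of_mem (Finset.mem_image_of_mem _ hz))).trans
      (by gcongr; exact min_le_left _ _)

lemma exists_quadratic_mul_measureReal_centeredSum_ge_le {g : ℝ → ℝ} (hg : Measurable g)
    {b : ℝ≥0} (hb : ∀ x, |g x| ≤ b) {ε : ℝ} (hθ : 0 ≤ θ) (hε : 0 < ε) :
    ∃ C : ℝ, 0 ≤ C ∧ ∀ (n : ℕ) (S : Finset (Fin n)),
      (3 + 6 * (θ * S.card) + (θ * S.card) ^ 2) *
        (Measure.pi fun _ : Fin n => μ).real {h | S.card * ε ≤ centeredSum μ g S h} ≤ C := by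
  -- Enlarging the bound keeps the rate `ε ^ 2 / (2 * b ^ 2)` away from the junk value at `b = 0`.
  have hb' (x : ℝ) : |g x| ≤ (b + 1 : ℝ≥0) := (hb x).trans (by simp)
  have hrate : 0 < ε ^ 2 / (2 * ((b + 1 : ℝ≥0) : ℝ) ^ 2) := by positivity
  refine ⟨_, by positivity, fun n S => le_trans ?_
    (quadratic_mul_exp_neg_le hθ hrate (Nat.cast_nonneg S.card))⟩
  gcongr
  exact measureReal_centeredSum_ge_le hg hb' hε.le S

lemma integrable_tanhSum_pow (hsymm : μ.map (fun h => -h) = μ) (hS : S.Nonempty) (p : ℕ) :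
    Integrable (fun h => tanhSum S h ^ p) (Measure.pi fun _ : Fin n => μ) :=
  integrable_pow_of_hasSubgaussianMGF (hasSubgaussianMGF_tanhSum hsymm hS) p

theorem exists_integral_fourthMoment_le (hsymm : μ.map (fun h => -h) = μ) (hθ : 0 < θ)
    (hθq : θ * meanSechSq μ < 1) (hmin : ZeroUniqueMinimizer μ θ) :
    ∃ C : ℝ, 0 ≤ C ∧ ∀ (n : ℕ) (S : Finset (Fin n)), S.Nonempty →
      ∫ h, fourthMoment θ S h ∂(Measure.pi fun _ : Fin n => μ) ≤ C := by
  obtain ⟨G, ε, C₀, hG, hε, hC₀, hgood⟩ := exists_fourthMoment_le_of_centeredSum_le hθ hθq hmin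
  have hdev (g : ℝ → ℝ) (hgG : g ∈ G) :=
    (hG g hgG).2.elim fun _ hb =>
      exists_quadratic_mul_measureReal_centeredSum_ge_le (μ := μ) (hG g hgG).1 hb hθ.le hε
  choose! C hC0 hC using hdev
  refine ⟨C₀ * (1 + 64) + ∑ g ∈ G, C g,
    add_nonneg (by positivity) (Finset.sum_nonneg hC0), fun n S hS => ?_⟩
  set π := Measure.pi fun _ : Fin n => μ
  set P := 3 + 6 * (θ * S.card) + (θ * S.card) ^ 2
  set D : (ℝ → ℝ) → Set (Fin n → ℝ) := fun g => {h | S.card * ε ≤ centeredSum μ g S h}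
  have hD (g : ℝ → ℝ) (hgG : g ∈ G) : MeasurableSet (D g) :=
    measurableSet_le measurable_const (measurable_centeredSum (hG g hgG).1 S)
  have hbad (g : ℝ → ℝ) (hgG : g ∈ G) : Integrable ((D g).indicator fun _ => P) π :=
    (integrable_const P).indicator (hD g hgG)
  have hpow := integrable_tanhSum_pow hsymm hS 4
  have hmain : Integrable (fun h => C₀ * (1 + tanhSum S h ^ 4)) π :=
    ((integrable_const 1).add hpow).const_mul C₀
  calc ∫ h, fourthMoment θ S h ∂π
      ≤ ∫ h, (C₀ * (1 + tanhSum S h ^ 4) + ∑ g ∈ G, (D g).indicator (fun _ => P) h) ∂π :=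
        integral_mono (integrable_gibbsAvg θ S μ _) (hmain.add (integrable_finsetSum G hbad))
          fun h => fourthMoment_le_add_sum_indicator hθ.le hC₀ G h (hgood n S hS h)
    _ = C₀ * (1 + ∫ h, tanhSum S h ^ 4 ∂π) + ∑ g ∈ G, P * π.real (D g) := by
        rw [integral_add hmain (integrable_finsetSum G hbad), integral_const_mul,
          integral_add (integrable_const 1) hpow, integral_const, probReal_univ, one_smul,
          integral_finsetSum G hbad]
        congr 1
        refine Finset.sum_congr rfl fun g hgG => ?_
        rw [integral_indicator_const _ (hD g hgG), smul_eq_mul, mul_comm]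
    _ ≤ C₀ * (1 + 64) + ∑ g ∈ G, C g :=
        add_le_add (by gcongr; exact integral_tanhSum_pow_four_le hsymm hS)
          (Finset.sum_le_sum fun g hgG => hC g hgG n S)

end FourthMoment

/-! ### Limit of the mean of the pair statistic -/

section Limit

variable {μ : Measure ℝ} {θ : ℝ} {n : ℕ} {S : Finset (Fin n)}

lemma abs_gibbsAvg_pairStat_sub_le_centeredSum (hθ : 0 ≤ θ) (hθq : θ * meanSechSq μ ≤ 1)
    (hS : S.Nonempty) (h : Fin n → ℝ) :
    |(1 - θ * meanSechSq μ) ^ 2 * gibbsAvg θ S h (fun σ => 1 + θ * pairStat S σ) -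
        (1 - θ * meanSechSq μ) - θ * tanhSum S h ^ 2| ≤
      (2 * Real.sqrt θ ^ 4 + 3 * Real.sqrt θ ^ 3 + Real.sqrt θ ^ 2) / Real.sqrt S.card *
        (tanhSum S h ^ 4 + (centeredSum μ sechSq S h / Real.sqrt S.card) ^ 4 +
          fourthMoment θ S h + 2) := by
  refine (abs_gibbsAvg_pairStat_sub_le hθ (meanSechSq_nonneg μ) hθq hS h).trans ?_
  have hk : (0 : ℝ) < S.card := by exact_mod_cast hS.card_pos
  set r := Real.sqrt S.card
  have hr0 : 0 < r := Real.sqrt_pos.2 hk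
  have hr2 : r ^ 2 = S.card := Real.sq_sqrt hk.le
  set X := centeredSum μ sechSq S h / r with hX
  have hmean : r * (sechSqMean S h - meanSechSq μ) ^ 2 = X ^ 2 / r := by
    rw [sechSqMean_sub_eq μ hS h, hX, ← hr2]
    field_simp
  have hsq : X ^ 2 ≤ 1 + X ^ 4 := by linarith [sq_nonneg (X ^ 2 - 1), sq_nonneg (X ^ 2)]
  rw [hmean, ← add_div, mul_div_assoc', div_mul_eq_mul_div]
  refine div_le_div_of_nonneg_right (mul_le_mul_of_nonneg_left ?_ (by positivity)) hr0.le
  linarith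

variable [IsProbabilityMeasure μ]

lemma meanSechSq_pos (μ : Measure ℝ) [IsProbabilityMeasure μ] : 0 < meanSechSq μ := by
  have hsupport : Function.support sechSq = Set.univ :=
    Set.eq_univ_of_forall fun x => (sechSq_pos x).ne'
  refine (integral_pos_iff_support_of_nonneg (fun x => (sechSq_pos x).le)
    (integrable_of_abs_le continuous_sechSq.measurable abs_sechSq_le_one)).2 ?_
  rw [hsupport, measure_univ]
  exact one_pos

lemma meanSechSq_le_one (μ : Measure ℝ) [IsProbabilityMeasure μ] : meanSechSq μ ≤ 1 :=
  (integral_mono (integrable_of_abs_le continuous_sechSq.measurable abs_sechSq_le_one)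
    (integrable_const 1) sechSq_le_one).trans_eq (by simp)

lemma one_lt_limitSecondMoment (hθ : 0 < θ) (hθq : θ * meanSechSq μ < 1) :
    1 < limitSecondMoment μ θ := by
  have hq := meanSechSq_pos μ
  have hq1 := meanSechSq_le_one μ
  unfold limitSecondMoment
  set q := meanSechSq μ
  have hc : 0 < 1 - θ * q := by linarith
  rw [one_lt_div (by positivity)]
  have hdiff : 0 < θ * q * (2 - q - θ * q) := mul_pos (mul_pos hθ hq) (by linarith)
  linarith

lemma integral_sub_tanhSum_sq (hsymm : μ.map (fun h => -h) = μ) (hθq : θ * meanSechSq μ < 1)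
    (hS : S.Nonempty) :
    ∫ h, ((1 - θ * meanSechSq μ) ^ 2 * gibbsAvg θ S h (fun σ => 1 + θ * pairStat S σ) -
        (1 - θ * meanSechSq μ) - θ * tanhSum S h ^ 2) ∂(Measure.pi fun _ : Fin n => μ) =
      θ * (1 - θ * meanSechSq μ) ^ 2 *
        (∫ σ, pairStat S σ ∂(plantedLaw μ θ S) - limitSecondMoment μ θ) := by
  have hc : 1 - θ * meanSechSq μ ≠ 0 := by linarith
  have hgibbs := (integrable_gibbsAvg θ S μ fun σ => 1 + θ * pairStat S σ).const_mul
    ((1 - θ * meanSechSq μ) ^ 2)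
  have hshift : Integrable (fun h => (1 - θ * meanSechSq μ) ^ 2 *
      gibbsAvg θ S h (fun σ => 1 + θ * pairStat S σ) - (1 - θ * meanSechSq μ))
      (Measure.pi fun _ : Fin n => μ) := hgibbs.sub (integrable_const _)
  have hsq := (integrable_tanhSum_pow hsymm hS 2).const_mul θ
  have hplanted : ∫ σ, (1 + θ * pairStat S σ) ∂(plantedLaw μ θ S) =
      1 + θ * ∫ σ, pairStat S σ ∂(plantedLaw μ θ S) := by
    rw [integral_add .of_finite .of_finite, integral_const_mul, integral_const, probReal_univ,
      one_smul]
  rw [integral_sub hshift hsq, integral_sub hgibbs (integrable_const _),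
    integral_const_mul, integral_const_mul, ← integral_plantedLaw, hplanted,
    integral_tanhSum_sq hsymm hS, integral_const, probReal_univ, one_smul, limitSecondMoment]
  field_simp
  ring

lemma abs_integral_pairStat_sub_le {C : ℝ} (hsymm : μ.map (fun h => -h) = μ) (hθ : 0 ≤ θ)
    (hθq : θ * meanSechSq μ < 1) (hS : S.Nonempty)
    (hC : ∫ h, fourthMoment θ S h ∂(Measure.pi fun _ : Fin n => μ) ≤ C) :
    θ * (1 - θ * meanSechSq μ) ^ 2 *
        |∫ σ, pairStat S σ ∂(plantedLaw μ θ S) - limitSecondMoment μ θ| ≤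
      (2 * Real.sqrt θ ^ 4 + 3 * Real.sqrt θ ^ 3 + Real.sqrt θ ^ 2) / Real.sqrt S.card *
        (64 + 64 + C + 2) := by
  set E := (2 * Real.sqrt θ ^ 4 + 3 * Real.sqrt θ ^ 3 + Real.sqrt θ ^ 2) / Real.sqrt S.card
  set π := Measure.pi fun _ : Fin n => μ
  set X : (Fin n → ℝ) → ℝ := fun h => centeredSum μ sechSq S h / Real.sqrt S.card
  have hX : HasSubgaussianMGF X (1 ^ 2) π :=
    hasSubgaussianMGF_centeredSum_div_sqrt continuous_sechSq.measurable
      (by simpa using abs_sechSq_le_one) hS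
  have htanh := integrable_tanhSum_pow hsymm hS 4
  have hsech : Integrable (fun h => X h ^ 4) π := integrable_pow_of_hasSubgaussianMGF hX 4
  have hfourth : Integrable (fourthMoment θ S) π := integrable_gibbsAvg θ S μ _
  have hsum : Integrable (fun h => tanhSum S h ^ 4 + X h ^ 4) π := htanh.add hsech
  have hsum' : Integrable (fun h => tanhSum S h ^ 4 + X h ^ 4 + fourthMoment θ S h) π :=
    hsum.add hfourth
  have hbound : Integrable
      (fun h => E * (tanhSum S h ^ 4 + X h ^ 4 + fourthMoment θ S h + 2)) π :=
    (hsum'.add (integrable_const 2)).const_mul E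
  have hXle : ∫ h, X h ^ 4 ∂π ≤ 64 := by
    simpa using integral_pow_four_le_of_hasSubgaussianMGF hX
  rw [← abs_of_nonneg (by positivity : 0 ≤ θ * (1 - θ * meanSechSq μ) ^ 2), ← abs_mul,
    ← integral_sub_tanhSum_sq hsymm hθq hS]
  calc |∫ h, ((1 - θ * meanSechSq μ) ^ 2 * gibbsAvg θ S h (fun σ => 1 + θ * pairStat S σ) -
        (1 - θ * meanSechSq μ) - θ * tanhSum S h ^ 2) ∂π|
      ≤ ∫ h, E * (tanhSum S h ^ 4 + X h ^ 4 + fourthMoment θ S h + 2) ∂π := by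
        rw [← Real.norm_eq_abs]
        exact norm_integral_le_of_norm_le hbound
          (ae_of_all π (abs_gibbsAvg_pairStat_sub_le_centeredSum hθ hθq.le hS))
    _ = E * (∫ h, tanhSum S h ^ 4 ∂π + ∫ h, X h ^ 4 ∂π + ∫ h, fourthMoment θ S h ∂π + 2) := by
        rw [integral_const_mul, integral_add hsum' (integrable_const 2), integral_add hsum hfourth,
          integral_add htanh hsech, integral_const, probReal_univ, one_smul]
    _ ≤ E * (64 + 64 + C + 2) := by
        gcongr
        exact integral_tanhSum_pow_four_le hsymm hS

lemma exists_abs_integral_pairStat_sub_le (hsymm : μ.map (fun h => -h) = μ) (hθ : 0 < θ)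
    (hθq : θ * meanSechSq μ < 1) (hmin : ZeroUniqueMinimizer μ θ) :
    ∃ C : ℝ, ∀ (n : ℕ) (S : Finset (Fin n)), S.Nonempty →
      |∫ σ, pairStat S σ ∂(plantedLaw μ θ S) - limitSecondMoment μ θ| ≤ C / Real.sqrt S.card := by
  obtain ⟨C, -, hC⟩ := exists_integral_fourthMoment_le hsymm hθ hθq hmin
  have hc : 0 < 1 - θ * meanSechSq μ := by linarith
  refine ⟨(2 * Real.sqrt θ ^ 4 + 3 * Real.sqrt θ ^ 3 + Real.sqrt θ ^ 2) * (64 + 64 + C + 2) /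
    (θ * (1 - θ * meanSechSq μ) ^ 2), fun n S hS => ?_⟩
  rw [div_right_comm, le_div_iff₀' (by positivity)]
  exact (abs_integral_pairStat_sub_le hsymm hθ.le hθq hS (hC n S hS)).trans_eq
    (div_mul_eq_mul_div _ _ _)

theorem tendsto_integral_pairStat {ι : Type*} {l : Filter ι} (hsymm : μ.map (fun h => -h) = μ)
    (hθ : 0 < θ) (hθq : θ * meanSechSq μ < 1) (hmin : ZeroUniqueMinimizer μ θ) (n : ι → ℕ)
    (S : ∀ j, Finset (Fin (n j))) (hS : Tendsto (fun j => (S j).card) l atTop) :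
    Tendsto (fun j => ∫ σ, pairStat (S j) σ ∂(plantedLaw μ θ (S j))) l
      (𝓝 (limitSecondMoment μ θ)) := by
  obtain ⟨C, hC⟩ := exists_abs_integral_pairStat_sub_le hsymm hθ hθq hmin
  have hlim : Tendsto (fun j => C / Real.sqrt ((S j).card : ℝ)) l (𝓝 0) :=
    (Real.tendsto_sqrt_atTop.comp (tendsto_natCast_atTop_atTop.comp hS)).const_div_atTop C
  rw [tendsto_iff_dist_tendsto_zero]
  refine squeeze_zero' (Eventually.of_forall fun j => dist_nonneg) ?_ hlim
  filter_upwards [hS.eventually_gt_atTop 0] with j hj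
  exact hC (n j) (S j) (Finset.card_pos.1 hj)

lemma le_min_add_sq_div {x B : ℝ} (hx : 0 ≤ x) (hB : 0 < B) : x ≤ min x B + x ^ 2 / B := by
  rcases le_total x B with h | h
  · rw [min_eq_left h]
    exact le_add_of_nonneg_right (by positivity)
  · have hsq : x ≤ x ^ 2 / B := by
      rw [le_div_iff₀ hB, sq]
      gcongr
    rw [min_eq_right h]
    linarith

lemma sq_mul_integral_pairStat_sq_le (hθ : 0 ≤ θ) (S : Finset (Fin n)) :
    θ ^ 2 * ∫ σ, pairStat S σ ^ 2 ∂(plantedLaw μ θ S) ≤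
      ∫ h, fourthMoment θ S h ∂(Measure.pi fun _ : Fin n => μ) := by
  rw [← integral_const_mul, integral_plantedLaw]
  refine integral_mono (integrable_gibbsAvg θ S μ _) (integrable_gibbsAvg θ S μ _) fun h =>
    gibbsAvg_mono θ S h fun σ => ?_
  rw [← mul_pow]
  linarith [mul_nonneg hθ (pairStat_nonneg S σ)]

lemma integral_pairStat_le_integral_min_add {C B : ℝ} (hθ : 0 < θ) (hB : 0 < B)
    (S : Finset (Fin n))
    (hC : ∫ h, fourthMoment θ S h ∂(Measure.pi fun _ : Fin n => μ) ≤ C) :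
    ∫ σ, pairStat S σ ∂(plantedLaw μ θ S) ≤
      ∫ σ, min (pairStat S σ) B ∂(plantedLaw μ θ S) + C / θ ^ 2 / B :=
  calc ∫ σ, pairStat S σ ∂(plantedLaw μ θ S)
      ≤ ∫ σ, (min (pairStat S σ) B + pairStat S σ ^ 2 / B) ∂(plantedLaw μ θ S) :=
        integral_mono .of_finite .of_finite fun σ => le_min_add_sq_div (pairStat_nonneg S σ) hB
    _ = ∫ σ, min (pairStat S σ) B ∂(plantedLaw μ θ S) +
          (∫ σ, pairStat S σ ^ 2 ∂(plantedLaw μ θ S)) / B := by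
        rw [integral_add .of_finite .of_finite, integral_div]
    _ ≤ _ := by
        gcongr
        rw [le_div_iff₀' (by positivity)]
        exact (sq_mul_integral_pairStat_sq_le hθ.le S).trans hC

theorem truncatedMeanExceeds_of_zeroUniqueMinimizer {τ : ℝ} (hsymm : μ.map (fun h => -h) = μ)
    (hθ : 0 < θ) (hθq : θ * meanSechSq μ < 1) (hmin : ZeroUniqueMinimizer μ θ)
    (hτ : τ < limitSecondMoment μ θ - 1) : TruncatedMeanExceeds μ θ τ := by
  obtain ⟨C, hC⟩ := exists_abs_integral_pairStat_sub_le hsymm hθ hθq hmin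
  obtain ⟨C₄, hC₄0, hC₄⟩ := exists_integral_fourthMoment_le hsymm hθ hθq hmin
  set V := limitSecondMoment μ θ
  obtain ⟨η, hη0, hη⟩ : ∃ η, 0 < η ∧ V = 1 + τ + 4 * η :=
    ⟨(V - 1 - τ) / 4, by linarith, by ring⟩
  set B := (C₄ / θ ^ 2 + 1) / η with hB
  have hB0 : 0 < B := by positivity
  refine ⟨B, η, hB0, hη0, max 1 ⌈(C / η) ^ 2⌉₊, fun n S hcard => ?_⟩
  obtain ⟨hS, hk⟩ := max_le_iff.1 hcard
  have hmean : V - η ≤ ∫ σ, pairStat S σ ∂(plantedLaw μ θ S) := by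
    have hrate : C / Real.sqrt S.card ≤ η := by
      rw [div_le_comm₀ (Real.sqrt_pos.2 (by exact_mod_cast hS)) hη0]
      exact Real.le_sqrt_of_sq_le (Nat.ceil_le.1 hk)
    linarith [(abs_le.1 (hC n S (Finset.card_pos.1 hS))).1]
  have htrunc := integral_pairStat_le_integral_min_add hθ hB0 S (hC₄ n S (Finset.card_pos.1 hS))
  have hsmall : C₄ / θ ^ 2 / B ≤ η := by
    rw [div_le_iff₀ hB0, hB, mul_div_cancel₀ _ hη0.ne']
    linarith
  linarith

end Limit

/-! ### Monotonicity in the interaction strength -/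

section Monotonicity

lemma sum_mul_sum_le_sum_mul_sum_of_monovary {ι : Type*} [Fintype ι] {w φ f : ι → ℝ}
    (hw : ∀ i, 0 ≤ w i) (hmono : Monovary φ f) :
    (∑ i, w i * f i) * ∑ i, w i * φ i ≤ (∑ i, w i * φ i * f i) * ∑ i, w i := by
  have hnonneg : 0 ≤ ∑ i, ∑ j, w i * w j * ((φ j - φ i) * (f j - f i)) :=
    Finset.sum_nonneg fun i _ => Finset.sum_nonneg fun j _ =>
      mul_nonneg (mul_nonneg (hw i) (hw j)) (hmono.sub_mul_sub_nonneg i j)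
  have hexpand (i j : ι) : w i * w j * ((φ j - φ i) * (f j - f i)) =
      (w i * φ i * f i) * w j + w i * (w j * φ j * f j) -
        ((w i * f i) * (w j * φ j) + (w i * φ i) * (w j * f j)) := by ring
  simp only [hexpand, Finset.sum_sub_distrib, Finset.sum_add_distrib, ← Finset.sum_mul_sum]
    at hnonneg
  linarith

variable {μ : Measure ℝ} [IsProbabilityMeasure μ] {θ θ₁ θ₂ τ : ℝ}

lemma weight_eq_weight_mul_exp {n : ℕ} (θ₁ θ₂ : ℝ) (S : Finset (Fin n)) (h : Fin n → ℝ)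
    (σ : Config n) :
    weight θ₂ S h σ = weight θ₁ S h σ * Real.exp ((θ₂ - θ₁) / 2 * pairStat S σ) := by
  rw [weight, weight, ← Real.exp_add, pairStat_eq]
  congr 1
  ring

lemma gibbsAvg_mono_theta {n : ℕ} (hθ : θ₁ ≤ θ₂) (S : Finset (Fin n)) (h : Fin n → ℝ)
    {F : ℝ → ℝ} (hF : Monotone F) :
    gibbsAvg θ₁ S h (fun σ => F (pairStat S σ)) ≤ gibbsAvg θ₂ S h (fun σ => F (pairStat S σ)) := by
  have hmono : Monovary (fun σ => Real.exp ((θ₂ - θ₁) / 2 * pairStat S σ))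
      (fun σ => F (pairStat S σ)) := fun σ τ hlt => by
    have hle : pairStat S σ ≤ pairStat S τ := (hF.reflect_lt hlt).le
    have hdiff : 0 ≤ θ₂ - θ₁ := sub_nonneg.2 hθ
    simp only
    gcongr
  rw [gibbsAvg_eq_div, gibbsAvg_eq_div,
    div_le_div_iff₀ (sum_weight_pos θ₁ S h) (sum_weight_pos θ₂ S h)]
  simp only [weight_eq_weight_mul_exp θ₁ θ₂]
  exact sum_mul_sum_le_sum_mul_sum_of_monovary (fun σ => (Real.exp_pos _).le) hmono

lemma TruncatedMeanExceeds.mono_theta (hθ : θ₁ ≤ θ₂) (h : TruncatedMeanExceeds μ θ₁ τ) :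
    TruncatedMeanExceeds μ θ₂ τ := by
  obtain ⟨B, η, hB, hη, K, hK⟩ := h
  refine ⟨B, η, hB, hη, K, fun n S hS => (hK n S hS).trans ?_⟩
  rw [integral_plantedLaw, integral_plantedLaw]
  exact integral_mono (integrable_gibbsAvg θ₁ S μ _) (integrable_gibbsAvg θ₂ S μ _) fun h =>
    gibbsAvg_mono_theta hθ S h (F := fun x => min x B) fun x y hxy => min_le_min_right B hxy

lemma logCosh_neg (x : ℝ) : logCosh (-x) = logCosh x := by
  rw [logCosh, Real.cosh_neg, logCosh]

lemma logCosh_le (a : ℝ) : logCosh a ≤ a ^ 2 / 2 := by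
  rw [logCosh, Real.log_le_iff_le_exp (Real.cosh_pos a)]
  exact Real.cosh_le_exp_half_sq a

lemma logCosh_add_add_logCosh_sub_le (a h : ℝ) :
    logCosh (a + h) + logCosh (a - h) ≤ 2 * logCosh a + 2 * logCosh h := by
  have hprod : Real.cosh (a + h) * Real.cosh (a - h) ≤ Real.cosh a ^ 2 * Real.cosh h ^ 2 := by
    rw [Real.cosh_add, Real.cosh_sub]
    linarith [sq_nonneg (Real.sinh a * Real.sinh h)]
  have hcosh (x : ℝ) : Real.cosh x ≠ 0 := (Real.cosh_pos x).ne'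
  have hlog := Real.log_le_log (mul_pos (Real.cosh_pos _) (Real.cosh_pos _)) hprod
  rw [Real.log_mul (hcosh _) (hcosh _), Real.log_mul (pow_ne_zero 2 (hcosh a))
    (pow_ne_zero 2 (hcosh h)), Real.log_pow, Real.log_pow] at hlog
  exact_mod_cast hlog

lemma energyGain_add_energyGain_neg_le (hθ : 0 ≤ θ) (x h : ℝ) :
    energyGain θ x h + energyGain θ x (-h) ≤ θ * x ^ 2 := by
  have hsq := logCosh_le (Real.sqrt θ * x)
  rw [mul_pow, Real.sq_sqrt hθ] at hsq
  rw [energyGain, energyGain, logCosh_neg, ← sub_eq_add_neg]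
  linarith [logCosh_add_add_logCosh_sub_le (Real.sqrt θ * x) h]

theorem zeroUniqueMinimizer_of_lt_one (hsymm : μ.map (fun h => -h) = μ) (hθ0 : 0 ≤ θ)
    (hθ1 : θ < 1) : ZeroUniqueMinimizer μ θ := by
  intro x hx
  have hgain := integrable_energyGain (μ := μ) θ x
  have hgain_neg : Integrable (fun h => energyGain θ x (-h)) μ :=
    integrable_of_abs_le ((continuous_energyGain θ x).comp continuous_neg).measurable
      fun h => abs_energyGain_le θ x (-h)
  have hreflect : ∫ h, energyGain θ x (-h) ∂μ = ∫ h, energyGain θ x h ∂μ := by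
    conv_rhs => rw [← hsymm]
    exact (integral_map measurable_neg.aemeasurable
      (continuous_energyGain θ x).aestronglyMeasurable).symm
  have hle : ∫ h, (energyGain θ x h + energyGain θ x (-h)) ∂μ ≤ θ * x ^ 2 :=
    (integral_mono (hgain.add hgain_neg) (integrable_const _)
      (energyGain_add_energyGain_neg_le hθ0 x)).trans_eq (by simp)
  rw [integral_add hgain hgain_neg, hreflect] at hle
  have hlt : θ * x ^ 2 < x ^ 2 := mul_lt_of_lt_one_left (by positivity) hθ1
  rw [freeEnergy_zero, freeEnergy_eq]
  linarith

end Monotonicity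

section GoodThresholds

variable {μ : Measure ℝ} [IsProbabilityMeasure μ] {θ τ : ℝ}

theorem tests_succeed_of_truncatedMeanExceeds (hsymm : μ.map (fun h => -h) = μ) (hτ : 0 < τ)
    (h : TruncatedMeanExceeds μ θ τ) :
    ScanTestSucceeds μ θ τ ∧ GlobalTestSucceeds μ θ τ ∧ CombinedTestSucceeds μ θ τ :=
  have hscan := scanTestSucceeds_of_truncatedMeanExceeds hsymm hτ h
  have hglobal := globalTestSucceeds_of_truncatedMeanExceeds hsymm hτ h
  ⟨hscan, hglobal, hscan.combinedTestSucceeds hglobal⟩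

/-- Weak coupling makes `0` the unique minimizer, and the truncated mean increases with the
coupling, so a threshold that is good at weak coupling stays good. -/
theorem exists_truncatedMeanExceeds (hsymm : μ.map (fun h => -h) = μ) (hθ : 0 < θ) :
    ∃ τ : ℝ, 0 < τ ∧ TruncatedMeanExceeds μ θ τ := by
  set θ' := min θ (1 / 2)
  have hθ'0 : 0 < θ' := by positivity
  have hθ'1 : θ' < 1 := (min_le_right _ _).trans_lt (by norm_num)
  have hθ'q : θ' * meanSechSq μ < 1 :=
    (mul_le_of_le_one_right hθ'0.le (meanSechSq_le_one μ)).trans_lt hθ'1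
  obtain ⟨τ, hτ0, hτ⟩ := exists_between (sub_pos.2 (one_lt_limitSecondMoment hθ'0 hθ'q))
  exact ⟨τ, hτ0, (truncatedMeanExceeds_of_zeroUniqueMinimizer hsymm hθ'0 hθ'q
    (zeroUniqueMinimizer_of_lt_one hsymm hθ'0.le hθ'1) hτ).mono_theta (min_le_left _ _)⟩

end GoodThresholds

end PlantedRFCW

end

open PlantedRFCW in
theorem mainTheorem3 (μ : Measure ℝ) [IsProbabilityMeasure μ]
    (hsymm : μ.map (fun h => -h) = μ) (θ : ℝ) (hθ : 0 < θ) (hhigh : θ < 1 / meanSechSq μ) :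
    1 < limitSecondMoment μ θ ∧
    (∃ τ : ℝ, 0 < τ ∧ ScanTestSucceeds μ θ τ ∧ GlobalTestSucceeds μ θ τ ∧
      CombinedTestSucceeds μ θ τ) ∧
    (ZeroUniqueMinimizer μ θ →
      (∀ (n : ℕ → ℕ) (S₀ : ∀ j, Finset (Fin (n j))),
        Tendsto (fun j => (S₀ j).card) atTop atTop →
        Tendsto (fun j => ∫ σ, pairStat (S₀ j) σ ∂(plantedLaw μ θ (S₀ j))) atTop
          (𝓝 (limitSecondMoment μ θ))) ∧
      ∀ τ : ℝ, 0 < τ → τ < limitSecondMoment μ θ - 1 →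
        ScanTestSucceeds μ θ τ ∧ GlobalTestSucceeds μ θ τ ∧ CombinedTestSucceeds μ θ τ) := by
  have hq : 0 < meanSechSq μ := meanSechSq_pos μ
  have hθq : θ * meanSechSq μ < 1 := (lt_div_iff₀ hq).1 hhigh
  obtain ⟨τ, hτ0, hτ⟩ := exists_truncatedMeanExceeds hsymm hθ
  exact ⟨one_lt_limitSecondMoment hθ hθq,
    ⟨τ, hτ0, tests_succeed_of_truncatedMeanExceeds hsymm hτ0 hτ⟩, fun hmin =>
    ⟨tendsto_integral_pairStat hsymm hθ hθq hmin, fun τ hτ0 hτ =>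
      tests_succeed_of_truncatedMeanExceeds hsymm hτ0
        (truncatedMeanExceeds_of_zeroUniqueMinimizer hsymm hθ hθq hmin hτ)⟩⟩
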